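/- Let $K$ be a field, $S=K[x_1,\dots,x_n]$ the standard graded polynomial ring, $\mathfrak m=(x_1,\dots,x_n)$, and $I\subseteq S$ a graded ideal. Let $F(I)=\bigoplus_{k\ge 0} I^k/\mathfrak m I^k$ be the fiber cone of $I$, let $\ell(I)=\dim F(I)$ (Krull dimension) be its analytic spread, let $\mu(\cdot)$ denote the minimal number of generators of an ideal, and put $$\Delta(I)=\mu(I^2)-\ell(I)\mu(I)+\binom{\ell(I)}{2}.$$ The ideal $I$ is equimultiple if $\operatorname{height}(I)=\ell(I)$. An ideal $J\subseteq \mathfrak a$ of a commutative ring is a reduction of the ideal $\mathfrak a$ if $\mathfrak a^{k+1}=J\mathfrak a^{k}$ for some $k\ge 0$; the least such $k$ is denoted $r_J(\mathfrak a)$; a reduction is minimal if it does not properly contain another reduction of $\mathfrak a$; and the reduction number is $r(\mathfrak a)=\min\{r_J(\mathfrak a)\mid J \text{ a minimal reduction of } \mathfrak a\}$. Let $r(I)$ denote the reduction number of the ideal $IS_{\mathfrak m}$ of the local ring $S_{\mathfrak m}$. (a) If $\Delta(I)=0$ and $F(I)$ is Cohen–Macaulay, then $r(I)\le 1$. If in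 addition $K$ is infinite and $\mu(I)\ne\ell(I)$, then $r(I)=1$. (b) If $K$ is infinite, $I$ is equimultiple and $r(I)\le 1$, then $\Delta(I)=0$ and $F(I)$ is Cohen–Macaulay. -/

import Mathlib

noncomputable section

namespace FreimanIdeal

/-! ### Reductions of ideals -/

section Reductions

variable {R : Type*} [CommRing R]

/-- `J` is a reduction of `I`: `J ⊆ I` and `I ^ (k + 1) = J * I ^ k` for some `k ≥ 0`. -/
def IsReduction (J I : Ideal R) : Prop :=
  J ≤ I ∧ ∃ k : ℕ, I ^ (k + 1) = J * I ^ k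

/-- `J` is a minimal reduction of `I`: it is a reduction of `I` which does not properly contain
any other reduction of `I`. -/
def IsMinimalReduction (J I : Ideal R) : Prop :=
  IsReduction J I ∧ ∀ J' : Ideal R, IsReduction J' I → ¬ J' < J

/-- The reduction number `r_J(I) = min {k | I ^ (k + 1) = J * I ^ k}` of `I` with respect to `J`
(equal to `⊤` when there is no such `k`, i.e. when `J ≤ I` is not a reduction of `I`). -/
def reductionNumberWrt (J I : Ideal R) : ℕ∞ :=
  ⨅ (k : ℕ) (_ : I ^ (k + 1) = J * I ^ k), (k : ℕ∞)

/-- The reduction number `r(I) = min {r_J(I) | J a minimal reduction of I}`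
(equal to `⊤` if `I` has no minimal reduction; in particular, `r(I) ≤ m` with `m` a natural number
includes the existence of a minimal reduction `J` of `I` with `r_J(I) ≤ m`). -/
def reductionNumber (I : Ideal R) : ℕ∞ :=
  ⨅ (J : Ideal R) (_ : IsMinimalReduction J I), reductionNumberWrt J I

end Reductions

/-! ### Cohen--Macaulay rings -/

/-- A local ring is Cohen--Macaulay if it is Noetherian and its maximal ideal contains a regular
sequence whose length is the Krull dimension, i.e. its depth equals its dimension (the depth, the
largest length of a regular sequence in the maximal ideal, never exceeds the dimension). -/
def IsCohenMacaulayLocal (R : Type*) [CommRing R] [IsLocalRing R] : Prop :=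
  IsNoetherianRing R ∧
    ∃ rs : List R, (∀ r ∈ rs, r ∈ IsLocalRing.maximalIdeal R) ∧
      RingTheory.Sequence.IsRegular R rs ∧ ((rs.length : ℕ∞) : WithBot ℕ∞) = ringKrullDim R

/-- A commutative ring is Cohen--Macaulay if it is Noetherian and its localization at every
maximal ideal is a Cohen--Macaulay local ring. -/
def IsCohenMacaulay (R : Type*) [CommRing R] : Prop :=
  IsNoetherianRing R ∧
    ∀ (p : Ideal R) [p.IsMaximal], IsCohenMacaulayLocal (Localization.AtPrime p)

/-! ### Graded ideals of a polynomial ring and their fiber cones -/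

section Polynomial

open MvPolynomial

attribute [local instance] MvPolynomial.gradedAlgebra

variable {K : Type*} [Field K] {n : ℕ}

/-- `I` is a graded ideal of `S = K[x_1, …, x_n]` with the standard grading. -/
def IsGraded (I : Ideal (MvPolynomial (Fin n) K)) : Prop :=
  I.IsHomogeneous (homogeneousSubmodule (Fin n) K)

variable (K n) in
/-- The graded maximal ideal `𝔪 = (x_1, …, x_n)` of `S = K[x_1, …, x_n]`. -/
def irrelevantIdeal : Ideal (MvPolynomial (Fin n) K) :=
  Ideal.span (Set.range X)

theorem irrelevantIdeal_eq_ker :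
    irrelevantIdeal K n = RingHom.ker (constantCoeff : MvPolynomial (Fin n) K →+* K) := by
  apply le_antisymm
  · rw [irrelevantIdeal, Ideal.span_le]
    rintro _ ⟨i, rfl⟩
    simp [RingHom.mem_ker]
  · intro f hf
    rw [RingHom.mem_ker, constantCoeff_eq] at hf
    rw [irrelevantIdeal, ← Set.image_univ, mem_ideal_span_X_image]
    intro m hm
    by_contra! h
    have : m = 0 := by
      ext i
      simpa using h i (Set.mem_univ i)
    subst this
    exact (mem_support_iff.mp hm) hf

instance irrelevantIdeal_isMaximal : (irrelevantIdeal K n).IsMaximal := by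
  rw [irrelevantIdeal_eq_ker]
  exact RingHom.ker_isMaximal_of_surjective _ fun a => ⟨C a, constantCoeff_C _ a⟩

/-- The fiber cone `F(I) = ⨁ₖ I ^ k / 𝔪 I ^ k`, as the quotient of the Rees algebra
`⨁ₖ I ^ k t ^ k` by the ideal generated by `𝔪`. -/
abbrev FiberCone (I : Ideal (MvPolynomial (Fin n) K)) : Type _ :=
  reesAlgebra I ⧸
    (irrelevantIdeal K n).map (algebraMap (MvPolynomial (Fin n) K) (reesAlgebra I))

/-- The analytic spread `ℓ(I)`, the Krull dimension of the fiber cone `F(I)`. (The fiber cone is a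
nonzero finitely generated `K`-algebra, so its Krull dimension is a natural number.) -/
def analyticSpread (I : Ideal (MvPolynomial (Fin n) K)) : ℕ :=
  ((ringKrullDim (FiberCone I)).unbotD 0).toNat

/-- The minimal number of generators `μ(I)`. -/
def mu (I : Ideal (MvPolynomial (Fin n) K)) : ℕ :=
  Submodule.spanFinrank I

/-- `Δ(I) = μ(I ^ 2) - ℓ(I) μ(I) + (ℓ(I) choose 2)`. -/
def Delta (I : Ideal (MvPolynomial (Fin n) K)) : ℤ :=
  (mu (I ^ 2) : ℤ) - (analyticSpread I : ℤ) * (mu I : ℤ) + ((analyticSpread I).choose 2 : ℤ)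

/-- `I` is equimultiple if `height I = ℓ(I)`. -/
def IsEquimultiple (I : Ideal (MvPolynomial (Fin n) K)) : Prop :=
  I.height = (analyticSpread I : ℕ∞)

/-- The ideal `I S_𝔪` of the local ring `S_𝔪`, where `S = K[x_1, …, x_n]`, `𝔪 = (x_1, …, x_n)`. -/
def localize (I : Ideal (MvPolynomial (Fin n) K)) :
    Ideal (Localization.AtPrime (irrelevantIdeal K n)) :=
  I.map (algebraMap (MvPolynomial (Fin n) K) (Localization.AtPrime (irrelevantIdeal K n)))

/-- The reduction number `r(I)` of a graded ideal `I` of `S = K[x_1, …, x_n]`, where reductions are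
taken locally at the graded maximal ideal, i.e. the reduction number of `I S_𝔪`. -/
def gradedReductionNumber (I : Ideal (MvPolynomial (Fin n) K)) : ℕ∞ :=
  reductionNumber (localize I)

end Polynomial

end FreimanIdeal

end

/-! Everything happens in the fiber cone F, which is also the fiber ring of the local ideal A = I
S_𝔪 (`nonempty_fiberRing_ringEquiv`). It is standard graded over the residue field k, with dim F_i =
μ(A^i) (`finrank_component`), and for graded ideals μ does not change under localization
(`spanFinrank_localize`). For J ≤ A let W ⊆ F_1 be the image of J. By Nakayama, J is a reduction
exactly when F_1 lies in the radical of (W), and A² = JA exactly when W F_1 = F_2.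

The number ℓμ - C(ℓ,2) is dim W F_1 when W is spanned by ℓ linear forms that behave like a regular
sequence in degree one: the form preceded by i others adds dim F_1 - i
(`finrank_span_range_mul_add_choose`).

(a) Let J be a minimal reduction. If F is Cohen–Macaulay, a linear system of parameters chosen
inside W is regular, so dim W F_1 is at least ℓμ - C(ℓ,2). When Δ = 0 this is dim F_2, and W F_1 =
F_2 follows (`mul_eq_of_isCohenMacaulay`). Choosing the parameters needs an infinite field, so the
count is made over the algebraic closure. If r = 0, then A is its own minimal reduction; lifts of a
Noether normalization by linear forms then generate A, and μ = ℓ.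

(b) Over an infinite residue field a minimal reduction L is generated by ℓ elements.
Equimultiplicity makes them a regular, hence quasi-regular, sequence in the Cohen–Macaulay ring S_𝔪.
Together with A² = LA this makes F free over the polynomial ring in their classes, on 1 and a basis
of a complement of W in F_1 (`coeff_eq_zero_of_isQuasiRegularFamily`,
`flat_aeval_of_forall_isHomogeneous`). Flatness gives both the Cohen–Macaulay property and the
dimension count. -/

namespace FreimanIdeal

open IsLocalRing RingTheory.Sequence
open scoped Pointwise

universe u

/-! ### Krull dimension and height: quotients and integral extensions. -/

section Dimension

/-- A chain of primes containing J can be prolonged downwards by a chain of length l ending at its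
smallest member. -/
theorem ringKrullDim_quotient_add_le {R : Type*} [CommRing R] (J : Ideal R) (l : ℕ)
    (h : ∀ q : Ideal R, q.IsPrime → J ≤ q → l ≤ q.height) :
    ringKrullDim (R ⧸ J) + l ≤ ringKrullDim R := by
  rw [ringKrullDim_quotient]
  by_cases hne : Nonempty (PrimeSpectrum.zeroLocus (R := R) J)
  swap
  · rw [not_nonempty_iff] at hne
    rw [Order.krullDim_eq_bot]
    simp
  have : Nonempty (PrimeSpectrum R) := hne.map Subtype.val
  rw [ringKrullDim, Order.krullDim_eq_iSup_length, Order.krullDim_eq_iSup_length]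
  have : (((⨆ p : LTSeries (PrimeSpectrum.zeroLocus (R := R) J), (p.length : ℕ∞)) + l : ℕ∞) :
      WithBot ℕ∞) ≤ ((⨆ p : LTSeries (PrimeSpectrum R), (p.length : ℕ∞)) : ℕ∞) := by
    rw [WithBot.coe_le_coe, ENat.iSup_add, iSup_le_iff]
    intro s
    have hs := h s.head.1.asIdeal s.head.1.2 s.head.2
    rw [PrimeSpectrum.height_eq_orderHeight] at hs
    obtain ⟨t, ht, htl⟩ := Order.exists_series_of_le_height _ hs
    refine le_trans ?_ (le_iSup _ (t.smash (s.map Subtype.val (fun _ _ ↦ id)) ht))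
    change (s.length : ℕ∞) + l ≤ ((t.length + s.length : ℕ) : ℕ∞)
    simp [htl, add_comm]
  exact_mod_cast this

variable {R S : Type*} [CommRing R] [CommRing S] [Algebra R S] [Algebra.IsIntegral R S]

theorem strictMono_comap_of_isIntegral :
    StrictMono (PrimeSpectrum.comap (algebraMap R S)) := fun P _ h =>
  Ideal.IsIntegral.comap_lt_comap (I := P.asIdeal) h

theorem ringKrullDim_le_of_isIntegral : ringKrullDim S ≤ ringKrullDim R :=
  Order.krullDim_le_of_strictMono _ strictMono_comap_of_isIntegral

theorem height_le_height_under_of_isIntegral (Q : Ideal S) [Q.IsPrime] :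
    Q.height ≤ (Q.under R).height := by
  have := Order.height_le_height_apply_of_strictMono _
    (strictMono_comap_of_isIntegral (R := R) (S := S)) ⟨Q, inferInstance⟩
  rwa [← PrimeSpectrum.height_eq_orderHeight, ← PrimeSpectrum.height_eq_orderHeight] at this

/-- Going up: the height of a prime whose fibre is a single prime does not drop. -/
theorem height_le_height_of_forall_liesOver [FaithfulSMul R S] (p : Ideal R) [p.IsPrime]
    (Q : Ideal S) [Q.IsPrime] (hQ : ∀ Q' : Ideal S, Q'.IsPrime → Q'.LiesOver p → Q' = Q) :
    p.height ≤ Q.height := by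
  refine ENat.forall_natCast_le_iff_le.mp fun n hn => ?_
  have hn' : (n : ℕ∞) ≤ Order.height (⟨p, inferInstance⟩ : PrimeSpectrum R) := by
    rwa [← PrimeSpectrum.height_eq_orderHeight]
  obtain ⟨l, hl, hln⟩ := Order.exists_series_of_le_height _ hn'
  obtain ⟨⟨P, hP, hPo⟩⟩ := Ideal.nonempty_primesOver (S := S) l.head.asIdeal
  obtain ⟨L, hL, -, hLl⟩ := Ideal.exists_ltSeries_of_hasGoingUp l P
  have hlast : L.last = ⟨Q, inferInstance⟩ := by
    have h1 : PrimeSpectrum.comap (algebraMap R S) L.last = l.last := by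
      have := List.getLast_congr (by simp [RelSeries.toList_ne_nil]) l.toList_ne_nil hLl
      rwa [List.getLast_map, RelSeries.getLast_toList, RelSeries.getLast_toList] at this
    rw [hl] at h1
    exact PrimeSpectrum.ext (hQ _ L.last.2 ⟨(congrArg PrimeSpectrum.asIdeal h1).symm⟩)
  have h1 := Order.length_le_height (p := L) (x := ⟨Q, inferInstance⟩) hlast.le
  rwa [hL, hln, ← PrimeSpectrum.height_eq_orderHeight] at h1

theorem ringKrullDim_eq_of_isIntegral [FaithfulSMul R S] : ringKrullDim S = ringKrullDim R := by
  refine le_antisymm ringKrullDim_le_of_isIntegral ?_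
  refine iSup_le fun l => ?_
  obtain ⟨⟨P, hP, hPo⟩⟩ := Ideal.nonempty_primesOver (S := S) l.head.asIdeal
  obtain ⟨L, hL, -, -⟩ := Ideal.exists_ltSeries_of_hasGoingUp l P
  rw [← hL]
  exact le_iSup (fun p : LTSeries (PrimeSpectrum S) => (p.length : WithBot ℕ∞)) L

end Dimension

/-! ### Depth and dimension of modules over a Noetherian local ring. -/

section LocalAlgebra

variable {R : Type u} [CommRing R] [IsNoetherianRing R] [IsLocalRing R]

open CategoryTheory Abelian Limits in
/-- Dividing by a regular element lowers the depth by at most one. -/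
theorem exists_isRegular_quotSMulTop {M : Type u} [AddCommGroup M] [Module R M] [Module.Finite R M]
    {n : ℕ} {rs : List R} (hlen : rs.length = n + 1) (hrs : ∀ r ∈ rs, r ∈ maximalIdeal R)
    (hreg : IsRegular M rs) {x : R} (hx : x ∈ maximalIdeal R) (hxM : IsSMulRegular M x) :
    ∃ rs' : List R, rs'.length = n ∧ (∀ r ∈ rs', r ∈ maximalIdeal R) ∧
      IsRegular (QuotSMulTop x M) rs' := by
  have hM : Nontrivial M := hreg.nontrivial
  have hM' : Nontrivial (QuotSMulTop x M) := nontrivial_quotSMulTop_of_mem_maximalIdeal M hx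
  have smul_lt (N : Type u) [AddCommGroup N] [Module R N] [Module.Finite R N] [Nontrivial N] :
      maximalIdeal R • (⊤ : Submodule R N) < ⊤ := by
    refine lt_top_iff_ne_top.mpr fun h => ?_
    exact (Submodule.top_ne_ideal_smul_of_le_jacobson_annihilator (M := N)
      ((maximalIdeal_le_jacobson _))) h.symm
  -- Depth is read off from the vanishing of Ext groups in low degrees; the long exact sequence of
  -- multiplication by x on M then costs one degree.
  have h := ((ModuleCat.exists_isRegular_tfae (maximalIdeal R) (n + 1) (ModuleCat.of R M)
    (smul_lt M)).out 1 3 rfl rfl).mpr ⟨rs, hlen, hrs, hreg⟩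
  refine ((ModuleCat.exists_isRegular_tfae (maximalIdeal R) n (ModuleCat.of R (QuotSMulTop x M))
    (smul_lt _)).out 1 3 rfl rfl).mp fun i hi => ?_
  have zero1 := AddCommGrpCat.isZero_of_iff_subsingleton.mpr (h i (by omega))
  have zero2 := AddCommGrpCat.isZero_of_iff_subsingleton.mpr (h (i + 1) (by omega))
  exact AddCommGrpCat.subsingleton_of_isZero <| ShortComplex.Exact.isZero_of_both_zeros
    ((Ext.covariant_sequence_exact₃' _
      (IsSMulRegular.smulShortComplex_shortExact (M := ModuleCat.of R M) hxM)) i (i + 1) rfl)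
    (zero1.eq_zero_of_src _) (zero2.eq_zero_of_tgt _)

/-- The depth of a module is at most the dimension of each of its associated primes. -/
theorem length_le_ringKrullDim_quotient_of_isAssociatedPrime (rs : List R)
    {M : Type u} [AddCommGroup M] [Module R M] [Module.Finite R M]
    (hrs : ∀ r ∈ rs, r ∈ maximalIdeal R) (hreg : IsRegular M rs)
    {p : Ideal R} (hp : IsAssociatedPrime p M) :
    (rs.length : WithBot ℕ∞) ≤ ringKrullDim (R ⧸ p) := by
  induction rs generalizing M p with
  | nil =>
    have := hp.isPrime
    simpa using ringKrullDim_nonneg_of_nontrivial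
  | cons x rs ih =>
    have hp' := hp.isPrime
    simp only [List.mem_cons, forall_eq_or_imp] at hrs
    obtain ⟨hxM, hreg'⟩ := (isRegular_cons_iff M x rs).mp hreg
    obtain ⟨-, u, hu⟩ := isAssociatedPrime_iff.mp hp
    have hxp : x ∉ p := by
      intro hx
      rw [hu, Submodule.mem_colon_singleton, Submodule.mem_bot] at hx
      have hu0 : u = 0 := hxM (by simpa using hx)
      refine hp'.ne_top ?_
      rw [hu, hu0, Ideal.eq_top_iff_one, Submodule.mem_colon_singleton]
      simp
    let N : Submodule R M := Submodule.torsionBySet R M p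
    have huN : u ∈ N := by
      rw [Submodule.mem_torsionBySet_iff]
      rintro ⟨a, ha⟩
      have : a ∈ p := ha
      rwa [hu, Submodule.mem_colon_singleton, Submodule.mem_bot] at this
    -- Here N consists of the elements killed by p. If it were inside xM, regularity of x would give
    -- N = xN, and Nakayama would kill N, which contains u.
    have hN : ¬ N ≤ x • (⊤ : Submodule R M) := by
      intro hle
      have : N ≤ Ideal.span {x} • N := by
        intro m hm
        obtain ⟨m', -, rfl⟩ := Submodule.mem_smul_pointwise_iff_exists _ _ _ |>.mp (hle hm)
        rw [Submodule.ideal_span_singleton_smul]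
        refine Submodule.smul_mem_pointwise_smul _ _ _ ?_
        rw [Submodule.mem_torsionBySet_iff] at hm ⊢
        intro a
        apply hxM
        have := hm a
        rw [smul_comm] at this
        simpa only [smul_zero] using this
      have hN0 := Submodule.eq_bot_of_le_smul_of_le_jacobson_bot (Ideal.span {x}) N
        (IsNoetherian.noetherian N) this
        ((Ideal.span_singleton_le_iff_mem _).mpr (maximalIdeal_le_jacobson _ hrs.1))
      rw [hN0, Submodule.mem_bot] at huN
      refine hp'.ne_top ?_
      rw [hu, huN, Ideal.eq_top_iff_one, Submodule.mem_colon_singleton]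
      simp
    obtain ⟨v, hvN, hv⟩ := SetLike.not_le_iff_exists.mp hN
    let v' : QuotSMulTop x M := Submodule.Quotient.mk v
    have hv' : v' ≠ 0 := by
      simpa [v', Submodule.Quotient.mk_eq_zero] using hv
    -- The class of v is nonzero in M/xM and is killed by p and by x. So some associated prime q of
    -- M/xM strictly contains p, and the induction hypothesis for q gains one dimension at p.
    obtain ⟨q, hq, hvq⟩ := exists_le_isAssociatedPrime_of_isNoetherianRing R v' hv'
    have hpq : p ≤ q := by
      intro a ha
      apply hvq
      rw [Submodule.mem_colon_singleton, Submodule.mem_bot]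
      have := (Submodule.mem_torsionBySet_iff (p : Set R) v).mp hvN ⟨a, ha⟩
      change Submodule.Quotient.mk (a • v) = 0
      simp only at this
      rw [this, Submodule.Quotient.mk_zero]
    have hxq : x ∈ q := by
      apply hvq
      rw [Submodule.mem_colon_singleton, Submodule.mem_bot]
      change Submodule.Quotient.mk (x • v) = 0
      rw [Submodule.Quotient.mk_eq_zero]
      exact Submodule.smul_mem_pointwise_smul _ _ _ trivial
    have h1 := ih hrs.2 hreg' hq
    have h2 : ringKrullDim (R ⧸ q) + 1 ≤ ringKrullDim (R ⧸ p) := by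
      refine ringKrullDim_succ_le_of_surjective (Ideal.Quotient.factor hpq)
        (Ideal.Quotient.factor_surjective hpq) (r := Ideal.Quotient.mk p x) ?_ ?_
      · rw [mem_nonZeroDivisors_iff_ne_zero]
        rwa [Ne, Ideal.Quotient.eq_zero_iff_mem]
      · simpa [Ideal.Quotient.eq_zero_iff_mem] using hxq
    refine le_trans ?_ h2
    push_cast [List.length_cons]
    gcongr

theorem zero_le_of_ne_bot {D : WithBot ℕ∞} (h : D ≠ ⊥) : 0 ≤ D := by
  induction D using WithBot.recBotCoe with
  | bot => simp at h
  | coe D => exact_mod_cast zero_le (a := D)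

theorem le_of_add_succ_le_succ {D : WithBot ℕ∞} {n l : ℕ} (h : D + (l + 1) ≤ n + 1) :
    D + l ≤ n := by
  induction D using WithBot.recBotCoe with
  | bot => simp
  | coe D =>
    induction D using ENat.recTopCoe with
    | top =>
      have h1 : ((⊤ : ℕ∞) : WithBot ℕ∞) + (l + 1) = ((⊤ + (l + 1) : ℕ∞) : WithBot ℕ∞) := by
        push_cast; rfl
      rw [h1, top_add] at h
      exact absurd (WithBot.coe_le_coe.mp h) (by simp)
    | coe D => norm_cast at h ⊢; omega

theorem not_le_of_add_succ_le {D : WithBot ℕ∞} {n l : ℕ} (h : D + (l + 1) ≤ n) :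
    ¬ (n : WithBot ℕ∞) ≤ D + l := by
  intro h'
  induction D using WithBot.recBotCoe with
  | bot => simp at h'
  | coe D =>
    induction D using ENat.recTopCoe with
    | top =>
      have h1 : ((⊤ : ℕ∞) : WithBot ℕ∞) + (l + 1) = ((⊤ + (l + 1) : ℕ∞) : WithBot ℕ∞) := by
        push_cast; rfl
      rw [h1, top_add] at h
      exact absurd (WithBot.coe_le_coe.mp h) (by simp)
    | coe D => norm_cast at h h'; omega

theorem supportDim_le_supportDim_quotient_add_length (xs : List R)
    {M : Type u} [AddCommGroup M] [Module R M] [Module.Finite R M]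
    (hxs : ∀ x ∈ xs, x ∈ maximalIdeal R) :
    Module.supportDim R M ≤
      Module.supportDim R (M ⧸ Ideal.ofList xs • (⊤ : Submodule R M)) + xs.length := by
  induction xs generalizing M with
  | nil =>
    rw [Ideal.ofList_nil, Submodule.bot_smul]
    simpa using (Module.supportDim_eq_of_equiv (Submodule.quotEquivOfEqBot ⊥ rfl)).ge
  | cons x xs ih =>
    simp only [List.mem_cons, forall_eq_or_imp] at hxs
    rw [Module.supportDim_eq_of_equiv
      (Submodule.quotOfListConsSMulTopEquivQuotSMulTopInner M x xs)]
    refine (Module.supportDim_le_supportDim_quotSMulTop_succ hxs.1).trans ?_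
    have := add_le_add_left (ih (M := QuotSMulTop x M) hxs.2) 1
    simpa [add_assoc] using this

/-- In a Cohen--Macaulay module, a sequence that cuts down the dimension fully is regular. -/
theorem isRegular_of_supportDim_add_length_le (xs : List R) {n : ℕ}
    {M : Type u} [AddCommGroup M] [Module R M] [Module.Finite R M]
    {rs : List R} (hlen : rs.length = n) (hrs : ∀ r ∈ rs, r ∈ maximalIdeal R)
    (hreg : IsRegular M rs) (hxs : ∀ x ∈ xs, x ∈ maximalIdeal R)
    (hdim : Module.supportDim R (M ⧸ Ideal.ofList xs • (⊤ : Submodule R M)) + xs.length ≤ n) :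
    IsRegular M xs := by
  induction xs generalizing n M rs with
  | nil =>
    have := hreg.nontrivial
    exact IsRegular.nil R M
  | cons x xs ih =>
    have hM := hreg.nontrivial
    simp only [List.mem_cons, forall_eq_or_imp] at hxs
    have hxM : IsSMulRegular M x := by
      -- A zero divisor x lies in an associated prime p, and dim R/p is at least the depth n. Since
      -- p contains x and the annihilator of M, cutting R/p by `xs` alone lands inside the support
      -- of M/(x, xs)M, so `xs`, which is one element shorter, would already cut down n dimensions.
      by_contra hcon
      have hmem : x ∈ ⋃ p ∈ associatedPrimes R M, (p : Set R) := by
        rw [biUnion_associatedPrimes_eq_compl_regular]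
        exact hcon
      simp only [Set.mem_iUnion] at hmem
      obtain ⟨p, hp, hxp⟩ := hmem
      have h1 := length_le_ringKrullDim_quotient_of_isAssociatedPrime rs hrs hreg hp
      have h2 := supportDim_le_supportDim_quotient_add_length xs hxs.2 (M := R ⧸ p)
      have h3 : Module.supportDim R ((R ⧸ p) ⧸ Ideal.ofList xs • (⊤ : Submodule R (R ⧸ p))) ≤
          Module.supportDim R (M ⧸ Ideal.ofList (x :: xs) • (⊤ : Submodule R M)) := by
        refine Order.krullDim_le_of_strictMono (fun a ↦ ⟨a.1, ?_⟩) (fun {_ _} lt ↦ lt)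
        obtain ⟨q, hq⟩ := a
        rw [Module.support_quotient, Module.support_eq_zeroLocus, Ideal.annihilator_quotient,
          ← PrimeSpectrum.zeroLocus_union, PrimeSpectrum.mem_zeroLocus, Set.union_subset_iff] at hq
        rw [Module.support_quotient]
        refine ⟨?_, ?_⟩
        · exact Module.mem_support_iff_of_finite.mpr
            ((Submodule.annihilator_top.symm.le.trans
              (IsAssociatedPrime.annihilator_le hp)).trans hq.1)
        · rw [PrimeSpectrum.mem_zeroLocus, Ideal.ofList_cons]
          exact sup_le ((Ideal.span_singleton_le_iff_mem _).mpr (hq.1 hxp)) hq.2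
      rw [Module.supportDim_quotient_eq_ringKrullDim] at h2
      exact absurd (h1.trans (h2.trans (add_le_add_left h3 _)))
        (not_le_of_add_succ_le (by simpa [hlen] using hdim))
    have hne : Module.supportDim R (M ⧸ Ideal.ofList (x :: xs) • (⊤ : Submodule R M)) ≠ ⊥ := by
      have : Nontrivial (M ⧸ Ideal.ofList (x :: xs) • (⊤ : Submodule R M)) := by
        refine Submodule.Quotient.nontrivial_iff.mpr (Ne.symm ?_)
        refine Submodule.top_ne_ideal_smul_of_le_jacobson_annihilator
          ((Ideal.span_le.mpr ?_).trans (maximalIdeal_le_jacobson _))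
        simpa [Set.subset_def] using hxs
      exact Module.supportDim_ne_bot_of_nontrivial R _
    obtain _ | n := n
    · refine absurd (zero_le_of_ne_bot hne) fun h0 => ?_
      have := (add_le_add_left h0 _).trans hdim
      norm_cast at this
    obtain ⟨rs', hlen', hrs', hreg'⟩ := exists_isRegular_quotSMulTop hlen hrs hreg hxs.1 hxM
    refine (isRegular_cons_iff M x xs).mpr ⟨hxM, ih hlen' hrs' hreg' hxs.2 ?_⟩
    rw [← Module.supportDim_eq_of_equiv
      (Submodule.quotOfListConsSMulTopEquivQuotSMulTopInner M x xs)]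
    exact le_of_add_succ_le_succ (by simpa using hdim)

end LocalAlgebra

end FreimanIdeal

namespace FreimanIdeal

open IsLocalRing RingTheory.Sequence
open scoped Pointwise

/-! ### Regular sequences are quasi-regular. -/

section QuasiRegular

open MvPolynomial

variable {R : Type*} [CommRing R]

/-- Elementwise form of weak regularity of a finite sequence on the ring itself. -/
def IsRegularFamily {s : ℕ} (x : Fin s → R) : Prop :=
  ∀ (i : Fin s) (a : R), a * x i ∈ Ideal.span (x '' Set.Iio i) → a ∈ Ideal.span (x '' Set.Iio i)

theorem isWeaklyRegular_ofFn_iff {s : ℕ} (x : Fin s → R) :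
    IsWeaklyRegular R (List.ofFn x) ↔ IsRegularFamily x := by
  have key (i : Fin s) : Ideal.ofList ((List.ofFn x).take i) • (⊤ : Submodule R R) =
      Ideal.span (x '' Set.Iio i) := by
    rw [smul_eq_mul, Ideal.mul_top, Ideal.ofList]
    congr 1
    ext y
    simp only [Set.mem_ofPred_eq, List.mem_take_iff_getElem, List.getElem_ofFn, List.length_ofFn,
      Set.mem_image, Set.mem_Iio]
    constructor
    · rintro ⟨j, hj, rfl⟩
      exact ⟨⟨j, by omega⟩, by rw [Fin.lt_def]; simp; omega, rfl⟩
    · rintro ⟨j, hj, rfl⟩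
      exact ⟨j, by rw [Fin.lt_def] at hj; omega, rfl⟩
  rw [isWeaklyRegular_iff, IsRegularFamily]
  constructor
  · intro h i a ha
    have h1 := h i (by simp)
    rw [isSMulRegular_quotient_iff_mem_of_smul_mem, key] at h1
    exact h1 a (by simpa [mul_comm] using ha)
  · intro h i hi
    have hi' : i < s := by simpa using hi
    rw [isSMulRegular_quotient_iff_mem_of_smul_mem, key ⟨i, hi'⟩]
    intro a ha
    exact h ⟨i, hi'⟩ a (by simpa [mul_comm] using ha)

variable {σ : Type*}

theorem eval_mem_mul_pow_of_coeff_mem {x : σ → R} {I : Ideal R} {Φ : MvPolynomial σ R} {d : ℕ}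
    (hΦ : Φ.IsHomogeneous d) (hI : ∀ m, Φ.coeff m ∈ I) :
    eval x Φ ∈ I * Ideal.span (Set.range x) ^ d := by
  rw [eval_eq]
  refine Ideal.sum_mem _ fun m hm => Ideal.mul_mem_mul (hI m) ?_
  refine (Ideal.mem_span_pow_iff_exists_isHomogeneous x _).mpr
    ⟨monomial m 1, isHomogeneous_monomial _ ?_, ?_⟩
  · rw [← hΦ (mem_support_iff.mp hm), Finsupp.degree_eq_weight_one]
    rfl
  · rw [eval_monomial, one_mul, Finsupp.prod]

theorem exists_isHomogeneous_coeff_mem_of_mem_mul_pow {x : σ → R} {I : Ideal R} {d : ℕ} {y : R}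
    (hy : y ∈ I * Ideal.span (Set.range x) ^ d) :
    ∃ Φ : MvPolynomial σ R, Φ.IsHomogeneous d ∧ (∀ m, Φ.coeff m ∈ I) ∧ eval x Φ = y := by
  refine Submodule.mul_induction_on hy ?_ ?_
  · intro a ha b hb
    obtain ⟨Φ, hΦ, rfl⟩ := (Ideal.mem_span_pow_iff_exists_isHomogeneous x b).mp hb
    refine ⟨C a * Φ, ?_, fun m => ?_, by simp⟩
    · simpa using (isHomogeneous_C σ a).mul hΦ
    · rw [coeff_C_mul]
      exact I.mul_mem_right _ ha
  · rintro _ _ ⟨Φ, h1, h2, rfl⟩ ⟨Ψ, h3, h4, rfl⟩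
    exact ⟨Φ + Ψ, h1.add h3, fun m => by simpa using I.add_mem (h2 m) (h4 m), by simp⟩

/-- The Rees property of a sequence: homogeneous relations have coefficients in the ideal. -/
def IsQuasiRegularFamily (x : σ → R) : Prop :=
  ∀ (d : ℕ) (Φ : MvPolynomial σ R), Φ.IsHomogeneous d → eval x Φ = 0 →
    ∀ m, Φ.coeff m ∈ Ideal.span (Set.range x)

/-- A value in the next power is also the value of a form of the same degree with coefficients in
the ideal; subtracting that form leaves a genuine relation. -/
theorem coeff_mem_of_eval_mem_pow {x : σ → R} {d : ℕ}
    (hx : ∀ Φ : MvPolynomial σ R, Φ.IsHomogeneous d → eval x Φ = 0 →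
      ∀ m, Φ.coeff m ∈ Ideal.span (Set.range x))
    {Φ : MvPolynomial σ R} (hΦ : Φ.IsHomogeneous d)
    (h : eval x Φ ∈ Ideal.span (Set.range x) ^ (d + 1)) (m : σ →₀ ℕ) :
    Φ.coeff m ∈ Ideal.span (Set.range x) := by
  rw [pow_succ'] at h
  obtain ⟨Ψ, h1, h2, h3⟩ := exists_isHomogeneous_coeff_mem_of_mem_mul_pow h
  have := hx (Φ - Ψ) (hΦ.sub h1) (by simp [h3]) m
  rw [coeff_sub] at this
  simpa using Ideal.add_mem _ this (h2 m)

theorem IsHomogeneous.exists_rename_add_X_mul {s d : ℕ} {Φ : MvPolynomial (Fin (s + 1)) R}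
    (hΦ : Φ.IsHomogeneous (d + 1)) :
    ∃ (G : MvPolynomial (Fin s) R) (H : MvPolynomial (Fin (s + 1)) R),
      G.IsHomogeneous (d + 1) ∧ H.IsHomogeneous d ∧
        Φ = rename Fin.castSucc G + X (Fin.last s) * H := by
  rw [Φ.as_sum]
  have key : ∀ m ∈ Φ.support, ∃ (G : MvPolynomial (Fin s) R) (H : MvPolynomial (Fin (s + 1)) R),
      G.IsHomogeneous (d + 1) ∧ H.IsHomogeneous d ∧
        monomial m (Φ.coeff m) = rename Fin.castSucc G + X (Fin.last s) * H := by
    intro m hm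
    have hd : m.degree = d + 1 := by
      rw [← hΦ (mem_support_iff.mp hm), Finsupp.degree_eq_weight_one]
      rfl
    by_cases h0 : m (Fin.last s) = 0
    · have hm' : (m.comapDomain Fin.castSucc (Fin.castSucc_injective s).injOn).mapDomain
          Fin.castSucc = m := by
        refine Finsupp.mapDomain_comapDomain _ (Fin.castSucc_injective s) _ fun i hi => ?_
        have : i ≠ Fin.last s := by
          rintro rfl
          exact (Finsupp.mem_support_iff.mp hi) h0
        exact ⟨i.castPred this, by simp⟩
      refine ⟨monomial (m.comapDomain Fin.castSucc (Fin.castSucc_injective s).injOn) (Φ.coeff m),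
        0, ?_, isHomogeneous_zero _ _ _, ?_⟩
      · refine isHomogeneous_monomial _ ?_
        rw [← Finsupp.degree_mapDomain Fin.castSucc, hm', hd]
      · rw [rename_monomial, mul_zero, add_zero]
        rw [hm']
    · have hle : m - Finsupp.single (Fin.last s) 1 + Finsupp.single (Fin.last s) 1 = m :=
        tsub_add_cancel_of_le (by simpa [Nat.one_le_iff_ne_zero] using h0)
      refine ⟨0, monomial (m - Finsupp.single (Fin.last s) 1) (Φ.coeff m),
        isHomogeneous_zero _ _ _, ?_, ?_⟩
      · refine isHomogeneous_monomial _ ?_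
        have := congrArg Finsupp.degree hle
        simp only [map_add, Finsupp.degree_single] at this
        omega
      · rw [map_zero, zero_add, X, monomial_mul, one_mul, add_comm (Finsupp.single _ _), hle]
  choose! G H h1 h2 h3 using key
  refine ⟨∑ m ∈ Φ.support, G m, ∑ m ∈ Φ.support, H m, IsHomogeneous.sum _ _ _ h1,
    IsHomogeneous.sum _ _ _ h2, ?_⟩
  rw [map_sum, Finset.mul_sum, ← Finset.sum_add_distrib]
  exact Finset.sum_congr rfl h3

/-- Quasi-regularity says that the associated graded ring is a polynomial ring over R/(x), so a
nonzerodivisor modulo (x) stays one modulo every power of (x). -/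
theorem IsQuasiRegularFamily.mem_pow_of_mul_mem_pow {x : σ → R} (hx : IsQuasiRegularFamily x)
    {z : R} (hz : ∀ a, a * z ∈ Ideal.span (Set.range x) → a ∈ Ideal.span (Set.range x))
    (k : ℕ) {a : R} (h : a * z ∈ Ideal.span (Set.range x) ^ k) :
    a ∈ Ideal.span (Set.range x) ^ k := by
  induction k with
  | zero => simp
  | succ k ih =>
    obtain ⟨Ψ, hΨ, rfl⟩ := (Ideal.mem_span_pow_iff_exists_isHomogeneous x a).mp
      (ih (Ideal.pow_le_pow_right k.le_succ h))
    have h1 := coeff_mem_of_eval_mem_pow (hx k) (Φ := C z * Ψ)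
      (by simpa using (isHomogeneous_C σ z).mul hΨ) (by simpa [mul_comm] using h)
    rw [pow_succ']
    refine eval_mem_mul_pow_of_coeff_mem (x := x) hΨ fun m => hz _ ?_
    have := h1 m
    rwa [coeff_C_mul, mul_comm] at this

/-- A regular sequence is quasi-regular. -/
theorem IsRegularFamily.isQuasiRegularFamily {s : ℕ} {x : Fin s → R} (hx : IsRegularFamily x) :
    IsQuasiRegularFamily x := by
  induction s with
  | zero =>
    intro d Φ _ h m
    have hΦ : Φ = C (Φ.coeff 0) := eq_C_of_isEmpty Φ
    have h0 : m = 0 := Subsingleton.elim _ _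
    rw [hΦ] at h
    simp only [eval_C] at h
    simp [h0, h]
  | succ s ih =>
    set x' : Fin s → R := fun i => x i.castSucc with hx'
    have hle : Ideal.span (Set.range x') ≤ Ideal.span (Set.range x) := by
      refine Ideal.span_mono ?_
      rintro _ ⟨i, rfl⟩
      exact ⟨_, rfl⟩
    have hqr : IsQuasiRegularFamily x' := by
      refine ih fun i a ha => ?_
      have : x' '' Set.Iio i = x '' Set.Iio i.castSucc := by
        ext y
        constructor
        · rintro ⟨j, hj, rfl⟩
          exact ⟨j.castSucc, Fin.castSucc_lt_castSucc_iff.mpr hj, rfl⟩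
        · rintro ⟨j, hj, rfl⟩
          have hj' : j < i.castSucc := hj
          exact ⟨j.castLT (by rw [Fin.lt_def] at hj'; simp at hj'; omega), by
            rw [Set.mem_Iio, Fin.lt_def]; exact hj', rfl⟩
      rw [this] at ha ⊢
      exact hx i.castSucc a ha
    have hz (a : R) (ha : a * x (Fin.last s) ∈ Ideal.span (Set.range x')) :
        a ∈ Ideal.span (Set.range x') := by
      have : Set.range x' = x '' Set.Iio (Fin.last s) := by
        ext y
        constructor
        · rintro ⟨j, rfl⟩
          exact ⟨j.castSucc, Fin.castSucc_lt_last j, rfl⟩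
        · rintro ⟨j, hj, rfl⟩
          exact ⟨j.castPred (ne_of_lt hj), by simp [x']⟩
      rw [this] at ha ⊢
      exact hx _ a ha
    intro d
    induction d with
    | zero =>
      intro Φ hΦ h m
      rw [← totalDegree_zero_iff_isHomogeneous, totalDegree_eq_zero_iff_eq_C] at hΦ
      rw [hΦ, eval_C] at h
      rw [hΦ, h]
      simp
    | succ d ihd =>
      intro Φ hΦ h
      -- Split off the last variable: Φ = G + X_s H. The relation puts x_s H(x) in the (d+1)-st
      -- power of (x'), and cancelling x_s puts H(x) there as well. Induction on the degree then
      -- handles the coefficients of H.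
      obtain ⟨G, H, hG, hH, rfl⟩ := IsHomogeneous.exists_rename_add_X_mul hΦ
      rw [map_add, eval_rename, map_mul, eval_X] at h
      have hG1 := eval_mem_mul_pow_of_coeff_mem (x := x') hG (I := ⊤) (fun _ => trivial)
      rw [Ideal.top_mul] at hG1
      have hH1 : eval x H ∈ Ideal.span (Set.range x') ^ (d + 1) := by
        refine hqr.mem_pow_of_mul_mem_pow hz (d + 1) ?_
        rw [mul_comm, eq_neg_of_add_eq_zero_right h]
        exact neg_mem hG1
      have hH2 := coeff_mem_of_eval_mem_pow ihd hH (Ideal.pow_right_mono hle _ hH1)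
      -- Rewriting H(x) as a form H' of degree d+1 in the earlier elements turns the relation into
      -- one among x' alone, which controls G up to multiples of x_s.
      obtain ⟨H', hH', hHH'⟩ := (Ideal.mem_span_pow_iff_exists_isHomogeneous x' _).mp hH1
      have hG2 := hqr (d + 1) (G + C (x (Fin.last s)) * H')
        (hG.add (by simpa using (isHomogeneous_C _ _).mul hH'))
        (by rw [map_add, map_mul]; simpa [hHH'] using! h)
      have hG3 (m) : G.coeff m ∈ Ideal.span (Set.range x) := by
        have h1 := hle (hG2 m)
        rw [coeff_add, coeff_C_mul] at h1
        have h2 := Ideal.mul_mem_right (H'.coeff m) _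
          (Ideal.subset_span (Set.mem_range_self (f := x) (Fin.last s)))
        simpa using Ideal.sub_mem _ h1 h2
      rw [← mem_map_C_iff] at hH2 hG3 ⊢
      refine Ideal.add_mem _ ?_ (Ideal.mul_mem_left _ _ hH2)
      have := Ideal.mem_map_of_mem (RingHomClass.toRingHom
        (rename Fin.castSucc : MvPolynomial (Fin s) R →ₐ[R] MvPolynomial (Fin (s + 1)) R)) hG3
      rw [Ideal.map_map] at this
      convert this using 2
      · ext a : 1
        simp
      · rfl

end QuasiRegular

/-! ### Monic polynomials in separate variables form a regular sequence. -/

section MonicFamily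

open MvPolynomial

/-- View the ring as P[X_0] with P the polynomial ring in the other variables. The sequence over P
stays regular by flatness, and a monic polynomial is a nonzerodivisor over every quotient of P. The
list is reversed because `finSuccEquiv` splits off the variable 0, which must come last. Taking f =
X gives the variables; general f serve for arbitrary maximal ideals. -/
theorem isWeaklyRegular_aeval_X_of_monic {R : Type*} [CommRing R] (n : ℕ) (f : Fin n → Polynomial R)
    (hf : ∀ i, (f i).Monic) :
    IsWeaklyRegular (MvPolynomial (Fin n) R)
      (List.ofFn fun i : Fin n =>
        Polynomial.aeval (X i.rev : MvPolynomial (Fin n) R) (f i.rev)) := by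
  induction n with
  | zero => simp
  | succ n ih =>
    let P := MvPolynomial (Fin n) R
    let g : Polynomial P := (f 0).map (algebraMap R P)
    have h1 : IsWeaklyRegular (Polynomial P)
        ((List.ofFn fun i : Fin n => Polynomial.aeval (X i.rev : P) (f i.rev.succ)).map
          (algebraMap P (Polynomial P))) :=
      (ih (fun i => f i.succ) fun i => hf _).of_flat
    have h2 : IsWeaklyRegular (Polynomial P)
        (((List.ofFn fun i : Fin n => Polynomial.aeval (X i.rev : P) (f i.rev.succ)).map
          (algebraMap P (Polynomial P))) ++ [g]) := by
      rw [isWeaklyRegular_append_iff]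
      refine ⟨h1, ?_⟩
      rw [isWeaklyRegular_singleton_iff, isSMulRegular_quotient_iff_mem_of_smul_mem,
        ← Ideal.map_ofList, smul_eq_mul, Ideal.mul_top]
      intro a ha
      have hiff (p : Polynomial P) (I : Ideal P) : p ∈ I.map (algebraMap P (Polynomial P)) ↔
          p.map (Ideal.Quotient.mk I) = 0 := by
        rw [Polynomial.algebraMap_eq, Ideal.mem_map_C_iff, Polynomial.ext_iff]
        simp [Ideal.Quotient.eq_zero_iff_mem]
      rw [hiff] at ha ⊢
      rw [smul_eq_mul, Polynomial.map_mul] at ha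
      exact (((hf 0).map _).map _).mul_right_eq_zero_iff.mp ha
    let e := finSuccEquiv R n
    refine (AddEquiv.isWeaklyRegular_congr (e := e.toRingEquiv.toAddEquiv)
      (List.forall₂_map_right_iff.mpr (List.forall₂_same.mpr fun r _ x => map_mul e r x))).mpr
      ((congrArg (IsWeaklyRegular (Polynomial P)) ?_).mp h2)
    rw [List.map_ofFn, List.ofFn_succ', List.concat_eq_append, List.map_append, List.map_ofFn]
    have he (i : Fin (n + 1)) : e (Polynomial.aeval (X i) (f i)) =
        Polynomial.aeval (e (X i)) (f i) := (Polynomial.aeval_algHom_apply e.toAlgHom _ _).symm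
    congr 1
    · congr 1
      funext i
      refine Eq.trans ?_ (he _).symm
      rw [Function.comp_apply, ← Polynomial.aeval_algebraMap_apply, Fin.rev_castSucc,
        finSuccEquiv_X_succ]
      rfl
    · rw [List.map_singleton, Fin.rev_last, he, finSuccEquiv_X_zero]
      rfl

end MonicFamily

end FreimanIdeal

/-! ### Standard graded algebras and Noether normalization by linear forms. -/

namespace FreimanIdeal

open IsLocalRing RingTheory.Sequence
open scoped Pointwise

open MvPolynomial (aeval)

theorem ideal_span_submodule_span {k F : Type*} [CommSemiring k] [CommSemiring F] [Algebra k F]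
    (s : Set F) : Ideal.span (Submodule.span k s : Set F) = Ideal.span s := by
  refine le_antisymm (Ideal.span_le.mpr fun x hx => ?_) (Ideal.span_mono Submodule.subset_span)
  have : Submodule.span k s ≤ (Ideal.span s).restrictScalars k :=
    Submodule.span_le.mpr Ideal.subset_span
  exact this hx

theorem mem_ideal_span_pow {k F : Type*} [CommSemiring k] [CommSemiring F] [Algebra k F]
    {V : Submodule k F} {n : ℕ} {x : F} (hx : x ∈ V ^ n) : x ∈ Ideal.span (V : Set F) ^ n := by
  induction n generalizing x with
  | zero => simp
  | succ n ih =>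
    rw [pow_succ] at hx ⊢
    refine Submodule.mul_induction_on hx (fun a ha b hb => ?_) fun a b => Ideal.add_mem _
    exact Ideal.mul_mem_mul (ih ha) (Ideal.subset_span hb)

section Homogeneous

open MvPolynomial

theorem _root_.MvPolynomial.IsHomogeneous.aeval_algebraMap_mul {σ k F : Type*} [CommSemiring k]
    [CommSemiring F] [Algebra k F] {q : MvPolynomial σ k} {d : ℕ} (hq : q.IsHomogeneous d)
    (a : σ → k) (θ : F) :
    MvPolynomial.aeval (fun i => algebraMap k F (a i) * θ) q =
      algebraMap k F (eval a q) * θ ^ d := by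
  rw [aeval_def, eval₂_eq, eval_eq, map_sum, Finset.sum_mul]
  refine Finset.sum_congr rfl fun m hm => ?_
  have hd : m.degree = d := by
    rw [← hq (mem_support_iff.mp hm), Finsupp.degree_eq_weight_one]
    rfl
  simp only [mul_pow, Finset.prod_mul_distrib, map_mul, map_prod, map_pow]
  rw [Finset.prod_pow_eq_pow_sum, ← hd, Finsupp.degree_apply, mul_assoc]

end Homogeneous

variable {k F : Type*} [Field k] [CommRing F] [Algebra k F]

/-- A graded algebra over a field is standard graded if it is generated by its finite-dimensional
component of degree one (and its component of degree zero is the field). -/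
structure IsStandardGraded (𝒜 : ℕ → Submodule k F) : Prop where
  eq_pow (i : ℕ) : 𝒜 i = 𝒜 1 ^ i
  fg : (𝒜 1).FG

namespace IsStandardGraded

variable {𝒜 : ℕ → Submodule k F} (h : IsStandardGraded 𝒜)
include h

theorem zero : 𝒜 0 = 1 := by rw [h.eq_pow 0, pow_zero]

theorem add_one (i : ℕ) : 𝒜 (i + 1) = 𝒜 1 * 𝒜 i := by rw [h.eq_pow, h.eq_pow i, pow_succ']

theorem fg_apply (i : ℕ) : (𝒜 i).FG := by
  rw [h.eq_pow]
  exact h.fg.pow i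

theorem finiteDimensional (i : ℕ) : FiniteDimensional k (𝒜 i) :=
  Module.Finite.iff_fg.mpr (h.fg_apply i)

theorem mem_of_pos {i : ℕ} (hi : i ≠ 0) {x : F} (hx : x ∈ 𝒜 i) :
    x ∈ Ideal.span (𝒜 1 : Set F) := by
  obtain ⟨j, rfl⟩ := Nat.exists_eq_succ_of_ne_zero hi
  rw [h.add_one] at hx
  refine Submodule.mul_induction_on hx (fun a ha b _ => ?_) fun a b => Ideal.add_mem _
  exact Ideal.mul_mem_right _ _ (Ideal.subset_span ha)

variable [GradedAlgebra 𝒜]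

theorem exists_sub_algebraMap_mem (x : F) :
    ∃ c : k, x - algebraMap k F c ∈ Ideal.span (𝒜 1 : Set F) ∧
      (DirectSum.decompose 𝒜 x 0 : F) = algebraMap k F c := by
  have h0 : (DirectSum.decompose 𝒜 x 0 : F) ∈ (1 : Submodule k F) := by
    rw [← h.zero]
    exact SetLike.coe_mem _
  obtain ⟨c, hc⟩ := Submodule.mem_one.mp h0
  refine ⟨c, ?_, hc.symm⟩
  classical
  rw [hc]
  nth_rw 1 [← DirectSum.sum_support_decompose 𝒜 x]
  by_cases hs : 0 ∈ (DirectSum.decompose 𝒜 x).support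
  · rw [← Finset.add_sum_erase _ _ hs, add_sub_cancel_left]
    refine Ideal.sum_mem _ fun i hi => h.mem_of_pos (Finset.ne_of_mem_erase hi) (SetLike.coe_mem _)
  · have : (DirectSum.decompose 𝒜 x 0 : F) = 0 := by
      simpa using hs
    rw [this, sub_zero]
    refine Ideal.sum_mem _ fun i hi => h.mem_of_pos ?_ (SetLike.coe_mem _)
    rintro rfl
    exact hs hi

omit h in
-- The link between ideals generated by linear forms and subspaces: membership in the ideal (W) can
-- be tested degree by degree.
theorem decompose_mem_mul_of_mem_span {W : Submodule k F} (hW : W ≤ 𝒜 1) {x : F}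
    (hx : x ∈ Ideal.span (W : Set F)) (n : ℕ) :
    (DirectSum.decompose 𝒜 x (n + 1) : F) ∈ W * 𝒜 n := by
  suffices ∀ f : F, (DirectSum.decompose 𝒜 (f * x) (n + 1) : F) ∈ W * 𝒜 n by
    -- Carrying an arbitrary multiplier f makes the statement stable under the scalar step of the
    -- span induction.
    simpa using this 1
  induction hx using Submodule.span_induction with
  | mem w hw =>
    intro f
    rw [DirectSum.coe_decompose_mul_add_of_right_mem 𝒜 (hW hw), mul_comm (_ : F) w]
    exact Submodule.mul_mem_mul hw (SetLike.coe_mem _)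
  | zero => simp
  | add x y _ _ hx hy =>
    intro f
    rw [mul_add, DirectSum.decompose_add, DirectSum.add_apply, Submodule.coe_add]
    exact add_mem (hx f) (hy f)
  | smul a x _ hx =>
    intro f
    rw [smul_eq_mul, ← mul_assoc]
    exact hx _

omit h in
theorem decompose_zero_of_mem_span {W : Submodule k F} (hW : W ≤ 𝒜 1) {x : F}
    (hx : x ∈ Ideal.span (W : Set F)) : (DirectSum.decompose 𝒜 x 0 : F) = 0 := by
  suffices ∀ f : F, (DirectSum.decompose 𝒜 (f * x) 0 : F) = 0 by
    simpa using this 1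
  induction hx using Submodule.span_induction with
  | mem w hw =>
    intro f
    exact DirectSum.coe_decompose_mul_of_right_mem_of_not_le 𝒜 (hW hw) (by simp)
  | zero => simp
  | add x y _ _ hx hy =>
    intro f
    rw [mul_add, DirectSum.decompose_add, DirectSum.add_apply, Submodule.coe_add, hx f, hy f,
      add_zero]
  | smul a x _ hx =>
    intro f
    rw [smul_eq_mul, ← mul_assoc]
    exact hx _

theorem mem_of_mem_span {W : Submodule k F} (hW : W ≤ 𝒜 1) {x : F}
    (hx : x ∈ Ideal.span (W : Set F)) (hx1 : x ∈ 𝒜 1) : x ∈ W := by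
  have := decompose_mem_mul_of_mem_span hW hx 0
  rwa [zero_add, DirectSum.decompose_of_mem_same 𝒜 hx1, h.zero, mul_one] at this

theorem isMaximal_span [Nontrivial F] : (Ideal.span (𝒜 1 : Set F)).IsMaximal := by
  rw [Ideal.isMaximal_iff]
  refine ⟨fun h1 => ?_, fun J x hJ hx hxJ => ?_⟩
  · have := decompose_zero_of_mem_span le_rfl h1
    rw [DirectSum.decompose_of_mem_same 𝒜 SetLike.GradedOne.one_mem] at this
    exact one_ne_zero this
  · obtain ⟨c, hc, -⟩ := h.exists_sub_algebraMap_mem x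
    have hc0 : c ≠ 0 := by
      rintro rfl
      simp [hx] at hc
    have h1 : algebraMap k F c ∈ J := by
      have := J.sub_mem hxJ (hJ hc)
      rwa [sub_sub_cancel] at this
    have := J.mul_mem_left (algebraMap k F c⁻¹) h1
    rwa [← map_mul, inv_mul_cancel₀ hc0, map_one] at this

/-- If every form of degree one lies in the radical of `(W)`, then `W` is a reduction. -/
theorem exists_mul_eq_of_mem_radical {W : Submodule k F} (hW : W ≤ 𝒜 1)
    (hr : ∀ v ∈ 𝒜 1, v ∈ (Ideal.span (W : Set F)).radical) :
    ∃ n, W * 𝒜 n = 𝒜 (n + 1) := by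
  obtain ⟨S, hS⟩ := h.fg
  have hfg : (Ideal.span (𝒜 1 : Set F)).FG := by
    rw [← hS, ideal_span_submodule_span]
    exact ⟨S, rfl⟩
  obtain ⟨n, hn⟩ := Ideal.exists_pow_le_of_le_radical_of_fg (Ideal.span_le.mpr hr) hfg
  refine ⟨n, le_antisymm ?_ fun x hx => ?_⟩
  · rw [h.add_one]
    exact mul_le_mul' hW le_rfl
  · have : x ∈ Ideal.span (W : Set F) := by
      refine hn (Ideal.pow_le_pow_right n.le_succ ?_)
      rw [h.eq_pow] at hx
      exact mem_ideal_span_pow hx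
    have := decompose_mem_mul_of_mem_span hW this n
    rwa [DirectSum.decompose_of_mem_same 𝒜 hx] at this

omit [GradedAlgebra 𝒜] in
theorem mem_radical_of_mul_eq {W : Submodule k F} {n : ℕ} (hn : W * 𝒜 n = 𝒜 (n + 1)) {v : F}
    (hv : v ∈ 𝒜 1) : v ∈ (Ideal.span (W : Set F)).radical := by
  refine ⟨n + 1, ?_⟩
  have : v ^ (n + 1) ∈ W * 𝒜 n := by
    rw [hn, h.eq_pow]
    exact Submodule.pow_mem_pow _ hv _
  refine Submodule.mul_induction_on this (fun a ha b _ => ?_) fun a b => Ideal.add_mem _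
  exact Ideal.mul_mem_right _ _ (Ideal.subset_span ha)

omit h in
theorem aeval_mem {σ : Type*} {w : σ → F} (hw : ∀ i, w i ∈ 𝒜 1) {q : MvPolynomial σ k} {d : ℕ}
    (hq : q.IsHomogeneous d) : aeval w q ∈ 𝒜 d := by
  rw [MvPolynomial.aeval_def, MvPolynomial.eval₂_eq]
  refine Submodule.sum_mem _ fun m hm => ?_
  rw [← Algebra.smul_def]
  refine Submodule.smul_mem _ _ ?_
  have hd : m.degree = d := by
    rw [← hq (MvPolynomial.mem_support_iff.mp hm), Finsupp.degree_eq_weight_one]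
    rfl
  have := SetLike.prod_pow_mem_graded 𝒜 (fun _ => 1) w (fun i => m i) (F := m.support)
    fun i _ => hw i
  simpa [← hd, Finsupp.degree_apply] using this

omit h in
theorem decompose_aeval {σ : Type*} {w : σ → F} (hw : ∀ i, w i ∈ 𝒜 1) (q : MvPolynomial σ k)
    (d : ℕ) : (DirectSum.decompose 𝒜 (aeval w q) d : F) =
      aeval w (MvPolynomial.homogeneousComponent d q) := by
  have hd (i : ℕ) := aeval_mem hw (MvPolynomial.homogeneousComponent_isHomogeneous i q)
  conv_lhs => rw [← q.sum_homogeneousComponent]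
  rw [map_sum, DirectSum.decompose_sum, DFinsupp.finsetSum_apply, AddSubmonoidClass.coe_finsetSum]
  rw [Finset.sum_eq_single d]
  · rw [DirectSum.decompose_of_mem_same 𝒜 (hd d)]
  · intro i _ hi
    exact DirectSum.decompose_of_mem_ne 𝒜 (hd i) hi
  · intro hn
    rw [MvPolynomial.homogeneousComponent_eq_zero _ _ (by simpa using hn)]
    simp

open MvPolynomial in
/-- Graded Noether normalization by linear forms, over an infinite field. -/
theorem exists_algebraicIndependent [Infinite k] [Nontrivial F] {W : Submodule k F} (hW : W ≤ 𝒜 1)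
    (hr : ∀ v ∈ 𝒜 1, v ∈ (Ideal.span (W : Set F)).radical) :
    ∃ (s : ℕ) (w : Fin s → F), (∀ i, w i ∈ W) ∧ AlgebraicIndependent k w ∧
      ∀ v ∈ 𝒜 1, v ∈ (Ideal.span (Set.range w)).radical := by
  classical
  -- The forms are taken with s minimal; algebraic independence will follow from minimality.
  let p : ℕ → Prop := fun s => ∃ w : Fin s → F, (∀ i, w i ∈ W) ∧
    ∀ v ∈ 𝒜 1, v ∈ (Ideal.span (Set.range w)).radical
  have hp : ∃ s, p s := by
    obtain ⟨s, w, hw⟩ := Submodule.fg_iff_exists_fin_generating_family.mp (h.fg.of_le hW)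
    refine ⟨s, w, fun i => hw ▸ Submodule.subset_span ⟨i, rfl⟩, fun v hv => ?_⟩
    rw [← ideal_span_submodule_span (k := k), hw]
    exact hr v hv
  obtain ⟨w, hwW, hw⟩ := Nat.find_spec hp
  refine ⟨_, w, hwW, ?_, hw⟩
  rw [algebraicIndependent_iff]
  intro P hP
  by_contra hP0
  obtain ⟨d, hd⟩ : ∃ d, homogeneousComponent d P ≠ 0 := by
    by_contra! hcon
    apply hP0
    rw [← P.sum_homogeneousComponent]
    exact Finset.sum_eq_zero fun i _ => hcon i
  have hq := homogeneousComponent_isHomogeneous d P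
  have hq0 : MvPolynomial.aeval w (homogeneousComponent d P) = 0 := by
    rw [← decompose_aeval (fun i => hW (hwW i)), hP]
    simp
  generalize homogeneousComponent d P = q at hd hq hq0
  -- This is the only use of the infinite field: a nonzero homogeneous relation q does not vanish at
  -- some point a.
  obtain ⟨a, ha⟩ : ∃ a, eval a q ≠ 0 := by
    by_contra! hcon
    exact hd (MvPolynomial.funext fun a => by simpa using hcon a)
  by_cases ha0 : ∀ i, a i = 0
  · obtain ⟨c, hc⟩ : ∃ c, q = C c := by
      have : d = 0 := by
        by_contra hd0
        apply ha
        rw [show a = 0 from _root_.funext ha0, eval_zero, constantCoeff_eq]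
        exact hq.coeff_eq_zero (by simpa using Ne.symm hd0)
      rw [this] at hq
      exact ⟨_, totalDegree_eq_zero_iff_eq_C.mp ((totalDegree_zero_iff_isHomogeneous _).mpr hq)⟩
    rw [hc] at hq0 hd
    rw [aeval_C, map_eq_zero_iff _ (algebraMap k F).injective] at hq0
    exact hd (by rw [hq0, C_0])
  · push Not at ha0
    obtain ⟨j, hj⟩ := ha0
    generalize hs : Nat.find hp = s at *
    obtain _ | t := s
    · exact j.elim0
    -- Modulo the forms w_i - (a_i/a_j) w_j with i ≠ j, the vector w equals aθ with θ = w_j/a_j.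
    -- Then 0 = q(w) = q(a) θ^d puts w_j in the radical of the ideal of these forms, so one form
    -- fewer suffices.
    refine Nat.find_min hp (m := t) (by omega) ⟨fun i => w (j.succAbove i) -
      (a (j.succAbove i) / a j) • w j, fun i => W.sub_mem (hwW _) (W.smul_mem _ (hwW _)), ?_⟩
    set I := Ideal.span (Set.range fun i => w (j.succAbove i) - (a (j.succAbove i) / a j) • w j)
      with hI
    have hmk (i : Fin (t + 1)) : Ideal.Quotient.mk I (w i) =
        algebraMap k (F ⧸ I) (a i) * ((a j)⁻¹ • Ideal.Quotient.mk I (w j)) := by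
      rw [← Algebra.smul_def, smul_smul, ← div_eq_mul_inv]
      by_cases hij : i = j
      · rw [hij, div_self hj, one_smul]
      · obtain ⟨i, rfl⟩ := Fin.exists_succAbove_eq hij
        rw [← Ideal.Quotient.mkₐ_eq_mk k, ← map_smul, Ideal.Quotient.mkₐ_eq_mk, Ideal.Quotient.eq]
        exact Ideal.subset_span ⟨i, rfl⟩
    have h1 := hq.aeval_algebraMap_mul a ((a j)⁻¹ • Ideal.Quotient.mk I (w j))
    simp only [← hmk] at h1
    have h2 : MvPolynomial.aeval (fun i => Ideal.Quotient.mk I (w i)) q = 0 := by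
      have := comp_aeval_apply w (Ideal.Quotient.mkₐ k I) q
      rw [hq0, map_zero] at this
      exact this.symm
    rw [h2, ← Algebra.smul_def, eq_comm, smul_eq_zero_iff_right ha, smul_pow,
      smul_eq_zero_iff_right (pow_ne_zero _ (inv_ne_zero hj)), ← map_pow,
      Ideal.Quotient.eq_zero_iff_mem] at h1
    have hwj : w j ∈ I.radical := ⟨d, h1⟩
    intro v hv
    refine (Ideal.radical_le_radical_iff.mpr ?_) (hw v hv)
    rw [Ideal.span_le]
    rintro _ ⟨i, rfl⟩
    have h3 := hmk i
    rw [← Algebra.smul_def, smul_smul, ← Ideal.Quotient.mkₐ_eq_mk k, ← map_smul,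
      Ideal.Quotient.mkₐ_eq_mk, Ideal.Quotient.eq] at h3
    have h4 := I.radical.add_mem (Ideal.le_radical h3)
      (Submodule.smul_of_tower_mem I.radical (a i * (a j)⁻¹) hwj)
    simpa using h4

end IsStandardGraded

end FreimanIdeal

/-! ### Counting dimensions, and finiteness over the normalization. -/

namespace FreimanIdeal

open IsLocalRing RingTheory.Sequence
open scoped Pointwise

open MvPolynomial (aeval)

/-- After localizing at p the sequence is regular, and dividing by it lowers the dimension by
exactly its length. -/
theorem length_le_height_of_isWeaklyRegular {R : Type*} [CommRing R] [IsNoetherianRing R]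
    (p : Ideal R) [p.IsPrime] {rs : List R} (hrs : IsWeaklyRegular R rs) (hp : ∀ r ∈ rs, r ∈ p) :
    rs.length ≤ p.height := by
  have h1 := hrs.isRegular_of_isLocalization_of_mem (Localization.AtPrime p) p hp
  have h2 := ringKrullDim_add_length_eq_ringKrullDim_of_isRegular _ h1
  rw [IsLocalization.AtPrime.ringKrullDim_eq_height p (Localization.AtPrime p)] at h2
  have h3 : (0 : WithBot ℕ∞) ≤ ringKrullDim (Localization.AtPrime p ⧸
      Ideal.ofList (rs.map (algebraMap R (Localization.AtPrime p)))) := by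
    have := h1.2
    rw [smul_eq_mul, Ideal.mul_top] at this
    have := Ideal.Quotient.nontrivial_iff.mpr this.symm
    exact ringKrullDim_nonneg_of_nontrivial
  rw [List.length_map] at h2
  have h4 : ((rs.length : ℕ∞) : WithBot ℕ∞) ≤ p.height := by
    rw [← h2]
    exact le_add_of_nonneg_left h3
  exact WithBot.coe_le_coe.mp h4

theorem le_height_irrelevantIdeal (k : Type*) [Field k] (n : ℕ) :
    n ≤ (irrelevantIdeal k n).height := by
  have := length_le_height_of_isWeaklyRegular (irrelevantIdeal k n)
    (isWeaklyRegular_aeval_X_of_monic n (fun _ => (Polynomial.X : Polynomial k))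
      fun _ => Polynomial.monic_X) ?_
  · simpa using this
  · intro r hr
    obtain ⟨i, rfl⟩ := List.mem_ofFn.mp hr
    rw [Polynomial.aeval_X]
    exact Ideal.subset_span ⟨_, rfl⟩

variable {k F : Type*} [Field k] [CommRing F] [Algebra k F]

theorem mem_ideal_span_of_mem_mul {W V : Submodule k F} {x : F} (hx : x ∈ W * V) :
    x ∈ Ideal.span (W : Set F) := by
  refine Submodule.mul_induction_on hx (fun a ha b _ => ?_) fun a b => Ideal.add_mem _
  exact Ideal.mul_mem_right _ _ (Ideal.subset_span ha)

/-- The kernel of (x, a) ↦ x + g(a) on A × V is the graph of -g over W, so rank-nullity applies. -/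
theorem finrank_sup_map_add_finrank {M : Type*} [AddCommGroup M] [Module k M]
    {A V W : Submodule k M} [FiniteDimensional k A] [FiniteDimensional k V] (hWV : W ≤ V)
    {g : M →ₗ[k] M} (hW : ∀ a ∈ V, g a ∈ A ↔ a ∈ W) :
    Module.finrank k (A ⊔ V.map g : Submodule k M) + Module.finrank k W =
      Module.finrank k A + Module.finrank k V := by
  let ψ : A × V →ₗ[k] M := A.subtype.coprod (g ∘ₗ V.subtype)
  have hrange : LinearMap.range ψ = A ⊔ V.map g := by
    rw [LinearMap.range_coprod, Submodule.range_subtype, LinearMap.range_comp,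
      Submodule.range_subtype]
  let φ : W →ₗ[k] A × V :=
    LinearMap.prod (LinearMap.codRestrict A (-(g ∘ₗ W.subtype)) fun x =>
      neg_mem ((hW x (hWV x.2)).mpr x.2)) (Submodule.inclusion hWV)
  have hφ : Function.Injective φ := fun x y hxy =>
    Submodule.inclusion_injective hWV (congrArg Prod.snd hxy)
  have hker : LinearMap.range φ = LinearMap.ker ψ := by
    refine le_antisymm ?_ ?_
    · rintro _ ⟨x, rfl⟩
      simp [ψ, φ, LinearMap.mem_ker]
    · rintro ⟨⟨x, hx⟩, ⟨a, ha⟩⟩ h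
      have h0 : x = - g a := eq_neg_of_add_eq_zero_left h
      have haW : a ∈ W := (hW a ha).mp (by rw [← neg_mem_iff, ← h0]; exact hx)
      exact ⟨⟨a, haW⟩, by ext <;> simp [φ, h0]⟩
  have h1 := LinearMap.finrank_range_add_finrank_ker ψ
  rwa [hrange, ← hker, LinearMap.finrank_range_of_inj hφ, Module.finrank_prod] at h1

/-- Adjoin the last form z to the span W of the earlier ones. For a in V, za lies in WV exactly when
a lies in W, so zV contributes dim V - dim W; the corrections 0 + 1 + ... + (s-1) sum to C(s,2). -/
theorem finrank_span_range_mul_add_choose {s : ℕ} (w : Fin s → F) (hli : LinearIndependent k w)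
    {V : Submodule k F} [FiniteDimensional k V] (hw : ∀ i, w i ∈ V)
    (hreg : ∀ i, ∀ a ∈ V, a * w i ∈ Ideal.span (w '' Set.Iio i) →
      a ∈ Submodule.span k (w '' Set.Iio i)) :
    Module.finrank k (Submodule.span k (Set.range w) * V : Submodule k F) + s.choose 2 =
      s * Module.finrank k V := by
  induction s with
  | zero =>
    rw [Set.range_eq_empty, Submodule.span_empty, Submodule.bot_mul]
    simp
  | succ s ih =>
    have himg (i : Fin s) : (w ∘ Fin.castSucc) '' Set.Iio i = w '' Set.Iio i.castSucc := by
      rw [Set.image_comp]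
      congr 1
      ext j
      simp only [Set.mem_image, Set.mem_Iio]
      constructor
      · rintro ⟨j, hj, rfl⟩
        exact Fin.castSucc_lt_castSucc_iff.mpr hj
      · intro hj
        obtain ⟨j, rfl⟩ := Fin.exists_castSucc_eq.mpr (hj.trans (Fin.castSucc_lt_last i)).ne
        exact ⟨j, Fin.castSucc_lt_castSucc_iff.mp hj, rfl⟩
    have hli' : LinearIndependent k (w ∘ Fin.castSucc) := hli.comp _ (Fin.castSucc_injective s)
    have ih' := ih (w ∘ Fin.castSucc) hli' (fun i => hw _) fun i => by
      rw [himg i]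
      exact hreg _
    have hlast : w '' Set.Iio (Fin.last s) = Set.range (w ∘ Fin.castSucc) := by
      rw [Set.range_comp]
      congr 1
      ext j
      simp only [Set.mem_Iio, Set.mem_range, Fin.exists_castSucc_eq, Fin.lt_last_iff_ne_last]
    have hlastreg := hreg (Fin.last s)
    rw [hlast] at hlastreg
    set W := Submodule.span k (Set.range (w ∘ Fin.castSucc)) with hW
    set z := w (Fin.last s) with hz
    have hWV : W ≤ V := Submodule.span_le.mpr (by rintro _ ⟨i, rfl⟩; exact hw _)
    have hfW : FiniteDimensional k W := Submodule.finiteDimensional_of_le hWV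
    have hfWV : FiniteDimensional k (W * V : Submodule k F) :=
      Module.Finite.iff_fg.mpr ((Module.Finite.iff_fg.mp hfW).mul (Module.Finite.iff_fg.mp ‹_›))
    have hspan : Submodule.span k (Set.range w) * V = W * V ⊔ V.map (LinearMap.mulLeft k z) := by
      have hspan : Submodule.span k (Set.range w) = W ⊔ Submodule.span k {z} := by
        rw [hW, ← Submodule.span_union]
        congr 1
        ext y
        simp only [Set.mem_range, Set.mem_union, Set.mem_singleton_iff, Fin.exists_fin_succ',
          Function.comp_apply]
        exact or_congr Iff.rfl eq_comm
      have hz : V.map (LinearMap.mulLeft k z) = Submodule.span k {z} * V :=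
        Submodule.ext fun y => Submodule.mem_span_singleton_mul.symm
      rw [hspan, hz]
      exact Submodule.sup_mul _ _ _
    have h1 := finrank_sup_map_add_finrank hWV (g := LinearMap.mulLeft k z) (A := W * V)
      fun a ha => by
        refine ⟨fun hza => hlastreg a ha ?_, fun haW => ?_⟩
        · rw [mul_comm, ← ideal_span_submodule_span (k := k)]
          exact mem_ideal_span_of_mem_mul hza
        · rw [LinearMap.mulLeft_apply, mul_comm z a]
          exact Submodule.mul_mem_mul haW (hw _)
    rw [← hspan, finrank_span_eq_card hli', Fintype.card_fin] at h1
    have h2 : (s + 1).choose 2 = s + s.choose 2 := by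
      rw [Nat.choose_succ_succ' s 1, Nat.choose_one_right]
    rw [h2, add_mul, one_mul]
    omega

namespace IsStandardGraded

variable {𝒜 : ℕ → Submodule k F} (h : IsStandardGraded 𝒜)
include h

/-- From degree n on every component is W times the preceding one, so the components of degree at
most n generate over P. -/
theorem finite_of_mul_eq [GradedAlgebra 𝒜] {P : Type*} [CommRing P] [Algebra k P] [Algebra P F]
    [IsScalarTower k P F] {W : Submodule k F} (hWP : ∀ x ∈ W, ∃ p, algebraMap P F p = x) {n : ℕ}
    (hn : W * 𝒜 n = 𝒜 (n + 1)) : Module.Finite P F := by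
  classical
  let N : Submodule k F := ⨆ i ∈ Finset.range (n + 1), 𝒜 i
  have hN : N.FG := Submodule.fg_biSup _ _ fun i _ => h.fg_apply i
  obtain ⟨S, hS⟩ := hN
  have hNM (x : F) (hx : x ∈ N) : x ∈ Submodule.span P (S : Set F) := by
    rw [← hS] at hx
    exact Submodule.span_le_restrictScalars k P _ hx
  have hall (i : ℕ) : ∀ x ∈ 𝒜 i, x ∈ Submodule.span P (S : Set F) := by
    induction i with
    | zero => exact fun x hx => hNM x (Submodule.mem_iSup_of_mem 0
        (Submodule.mem_iSup_of_mem (by simp) hx))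
    | succ i ih =>
      by_cases hi : i + 1 ≤ n
      · exact fun x hx => hNM x (Submodule.mem_iSup_of_mem (i + 1)
          (Submodule.mem_iSup_of_mem (by simpa using hi) hx))
      · have : 𝒜 (i + 1) = W * 𝒜 i := by
          obtain ⟨j, rfl⟩ := Nat.exists_eq_add_of_le (show n ≤ i by omega)
          rw [h.eq_pow (n + j + 1), h.eq_pow (n + j), pow_add (𝒜 1) n j, ← mul_assoc, ← h.eq_pow n,
            hn, h.eq_pow (n + 1), ← pow_add]
          congr 1
          omega
        intro x hx
        rw [this] at hx
        refine Submodule.mul_induction_on hx (fun a ha b hb => ?_) fun a b => add_mem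
        obtain ⟨p, rfl⟩ := hWP a ha
        rw [← Algebra.smul_def]
        exact Submodule.smul_mem _ _ (ih b hb)
  refine ⟨⟨S, eq_top_iff.mpr fun x _ => ?_⟩⟩
  rw [← DirectSum.sum_support_decompose 𝒜 x]
  exact Submodule.sum_mem _ fun i _ => hall i _ (SetLike.coe_mem _)

variable [GradedAlgebra 𝒜] {s : ℕ} {w : Fin s → F} (hw : ∀ i, w i ∈ 𝒜 1)
  (hr : ∀ v ∈ 𝒜 1, v ∈ (Ideal.span (Set.range w)).radical)
include hw hr

theorem exists_span_range_mul_eq : ∃ n, Submodule.span k (Set.range w) * 𝒜 n = 𝒜 (n + 1) := by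
  refine h.exists_mul_eq_of_mem_radical ?_ (by rwa [ideal_span_submodule_span])
  exact Submodule.span_le.mpr (by rintro _ ⟨i, rfl⟩; exact hw i)

theorem finite_aeval : (aeval (R := k) w).toRingHom.Finite := by
  obtain ⟨n, hn⟩ := h.exists_span_range_mul_eq hw hr
  let := (aeval (R := k) w).toRingHom.toAlgebra
  have : IsScalarTower k (MvPolynomial (Fin s) k) F :=
    .of_algebraMap_eq fun x => ((aeval (R := k) w).commutes x).symm
  refine h.finite_of_mul_eq (fun x hx => ?_) hn
  have hle : Submodule.span k (Set.range w) ≤ LinearMap.range (aeval (R := k) w).toLinearMap := by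
    rw [Submodule.span_le]
    rintro _ ⟨i, rfl⟩
    exact ⟨MvPolynomial.X i, MvPolynomial.aeval_X w i⟩
  exact hle hx

variable (hai : AlgebraicIndependent k w)
include hai

theorem ringKrullDim_eq : ringKrullDim F = s := by
  let := (aeval (R := k) w).toRingHom.toAlgebra
  have : Module.Finite (MvPolynomial (Fin s) k) F := h.finite_aeval hw hr
  have : FaithfulSMul (MvPolynomial (Fin s) k) F :=
    (faithfulSMul_iff_algebraMap_injective _ _).mpr hai
  rw [ringKrullDim_eq_of_isIntegral (R := MvPolynomial (Fin s) k),
    MvPolynomial.ringKrullDim_of_isNoetherianRing]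
  simp

/-- Only the irrelevant ideal lies over (X_1, …, X_s), so going-up transfers the height. This
ensures that the localization at the irrelevant ideal has the full dimension of F. -/
theorem le_height_span [Nontrivial F] : s ≤ (Ideal.span (𝒜 1 : Set F)).height := by
  let := (aeval (R := k) w).toRingHom.toAlgebra
  have : Module.Finite (MvPolynomial (Fin s) k) F := h.finite_aeval hw hr
  have : FaithfulSMul (MvPolynomial (Fin s) k) F :=
    (faithfulSMul_iff_algebraMap_injective _ _).mpr hai
  have := h.isMaximal_span
  refine (le_height_irrelevantIdeal k s).trans
    (height_le_height_of_forall_liesOver _ _ fun Q hQ hQo => ?_)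
  refine (h.isMaximal_span.eq_of_le hQ.ne_top (Ideal.span_le.mpr fun v hv => ?_)).symm
  refine hQ.radical_le_iff.mpr ?_ (hr v hv)
  rw [Ideal.span_le]
  rintro _ ⟨i, rfl⟩
  have h1 : MvPolynomial.X i ∈ irrelevantIdeal k s := Ideal.subset_span ⟨i, rfl⟩
  rw [hQo.over] at h1
  have h2 : aeval w (MvPolynomial.X i) ∈ Q := h1
  rwa [MvPolynomial.aeval_X] at h2

end IsStandardGraded

end FreimanIdeal

/-! ### Linear parameters at the irrelevant ideal of a Cohen–Macaulay algebra. -/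

namespace FreimanIdeal

open IsLocalRing RingTheory.Sequence
open scoped Pointwise

open MvPolynomial (aeval)

theorem IsWeaklyRegular.isRegular_of_mem_maximalIdeal {R : Type*} [CommRing R] [IsLocalRing R]
    {rs : List R} (h : IsWeaklyRegular R rs) (hrs : ∀ r ∈ rs, r ∈ maximalIdeal R) :
    IsRegular R rs :=
  (isRegular_iff_isWeaklyRegular_of_subset_maximalIdeal hrs).mpr h

theorem exists_isRegular_of_flat {F G : Type*} [CommRing F] [CommRing G] [Algebra F G]
    [Module.Flat F G] {p : Ideal F} {q : Ideal G} [p.IsPrime] [q.IsPrime]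
    (hpq : p = q.comap (algebraMap F G))
    {rs : List (Localization.AtPrime p)} (hrs : ∀ r ∈ rs, r ∈ maximalIdeal _)
    (hreg : IsRegular (Localization.AtPrime p) rs) :
    ∃ rs' : List (Localization.AtPrime q), rs'.length = rs.length ∧
      (∀ r ∈ rs', r ∈ maximalIdeal _) ∧ IsRegular (Localization.AtPrime q) rs' := by
  let f := Localization.localRingHom p q (algebraMap F G) hpq
  have hf : f.Flat :=
    RingHom.Flat.localRingHom (RingHom.flat_algebraMap_iff.mpr inferInstance) _ _ _
  let := f.toAlgebra
  have : Module.Flat (Localization.AtPrime p) (Localization.AtPrime q) := hf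
  have hloc : IsLocalHom f := inferInstance
  have hmem : ∀ r ∈ rs.map f, r ∈ maximalIdeal (Localization.AtPrime q) := by
    intro r hr
    obtain ⟨r, hr', rfl⟩ := List.mem_map.mp hr
    exact map_nonunit f r (hrs r hr')
  exact ⟨rs.map f, List.length_map _, hmem, IsWeaklyRegular.isRegular_of_mem_maximalIdeal
    (hreg.toIsWeaklyRegular.of_flat (S := Localization.AtPrime q)) hmem⟩

variable {k F : Type*} [Field k] [CommRing F] [Algebra k F]

namespace IsStandardGraded

variable {𝒜 : ℕ → Submodule k F} (h : IsStandardGraded 𝒜)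
include h

section

variable [GradedAlgebra 𝒜] {s : ℕ} {w : Fin s → F} (hw : ∀ i, w i ∈ 𝒜 1)
  (hr : ∀ v ∈ 𝒜 1, v ∈ (Ideal.span (Set.range w)).radical)
include hw

/-- The dimension count for linear forms forming a regular sequence at the irrelevant ideal. -/
theorem finrank_span_range_mul_add_choose_of_isRegularFamily [(Ideal.span (𝒜 1 : Set F)).IsPrime]
    (hli : LinearIndependent k w)
    (hreg : IsRegularFamily fun i =>
      algebraMap F (Localization.AtPrime (Ideal.span (𝒜 1 : Set F))) (w i)) :
    Module.finrank k (Submodule.span k (Set.range w) * 𝒜 1 : Submodule k F) + s.choose 2 =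
      s * Module.finrank k (𝒜 1) := by
  have := h.finiteDimensional 1
  refine finrank_span_range_mul_add_choose w hli hw fun i a ha hai => ?_
  have h1 := hreg i (algebraMap F _ a) (by
    rw [← map_mul, ← Function.comp_def (algebraMap F _) w, Set.image_comp, ← Ideal.map_span]
    exact Ideal.mem_map_of_mem _ hai)
  rw [← Function.comp_def (algebraMap F _) w, Set.image_comp, ← Ideal.map_span,
    IsLocalization.algebraMap_mem_map_algebraMap_iff (Ideal.span (𝒜 1 : Set F)).primeCompl] at h1
  -- Clearing denominators leaves ta in the ideal of the earlier forms, with t outside the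
  -- irrelevant ideal. The degree-one part of ta is ca, where c ≠ 0 is the constant term of t.
  obtain ⟨t, ht, hta⟩ := h1
  obtain ⟨c, hc, hc'⟩ := h.exists_sub_algebraMap_mem t
  have hc0 : c ≠ 0 := by
    rintro rfl
    rw [map_zero, sub_zero] at hc
    exact ht hc
  rw [← ideal_span_submodule_span (k := k)] at hta
  have hWV : Submodule.span k (w '' Set.Iio i) ≤ 𝒜 1 :=
    Submodule.span_le.mpr (by rintro _ ⟨j, -, rfl⟩; exact hw j)
  have h2 := decompose_mem_mul_of_mem_span hWV hta 0
  rw [h.zero, mul_one, DirectSum.coe_decompose_mul_add_of_right_mem 𝒜 ha, hc',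
    ← Algebra.smul_def] at h2
  exact (Submodule.smul_mem_iff _ hc0).mp h2

include hr

omit h [GradedAlgebra 𝒜] in
-- The radical condition makes the quotient of the localization by the w_i zero-dimensional, and
-- `isRegular_of_supportDim_add_length_le` turns such parameters into a regular sequence.
theorem isRegularFamily_of_isRegular [IsNoetherianRing F] [(Ideal.span (𝒜 1 : Set F)).IsMaximal]
    {rs : List (Localization.AtPrime (Ideal.span (𝒜 1 : Set F)))}
    (hrs : ∀ r ∈ rs, r ∈ maximalIdeal _)
    (hreg : IsRegular (Localization.AtPrime (Ideal.span (𝒜 1 : Set F))) rs)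
    (hs : s ≤ rs.length) :
    IsRegularFamily fun i =>
      algebraMap F (Localization.AtPrime (Ideal.span (𝒜 1 : Set F))) (w i) := by
  set m := Ideal.span (𝒜 1 : Set F) with hm
  set B := Localization.AtPrime m
  rw [← isWeaklyRegular_ofFn_iff]
  have hmem : ∀ x ∈ List.ofFn fun i => algebraMap F B (w i), x ∈ maximalIdeal B := by
    intro x hx
    obtain ⟨i, rfl⟩ := List.mem_ofFn.mp hx
    exact (IsLocalization.AtPrime.to_map_mem_maximal_iff B m _).mpr (Ideal.subset_span (hw i))
  refine (isRegular_of_supportDim_add_length_le _ rfl hrs hreg hmem ?_).toIsWeaklyRegular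
  have hdim : Module.supportDim B (B ⧸ Ideal.ofList (List.ofFn fun i => algebraMap F B (w i)) •
      (⊤ : Submodule B B)) ≤ 0 := by
    rw [smul_eq_mul, Ideal.mul_top, Module.supportDim_quotient_eq_ringKrullDim, ← Nat.cast_zero,
      ← Ring.krullDimLE_iff]
    set J := Ideal.ofList (List.ofFn fun i => algebraMap F B (w i))
    refine Ring.KrullDimLE.mk₀ fun Q hQ => ?_
    have hQ' : (Q.comap (Ideal.Quotient.mk J)).IsPrime := inferInstance
    have hmQ : m ≤ (Q.comap (Ideal.Quotient.mk J)).comap (algebraMap F B) := by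
      refine Ideal.span_le.mpr fun v hv => ?_
      have hp : ((Q.comap (Ideal.Quotient.mk J)).comap (algebraMap F B)).IsPrime := inferInstance
      refine hp.radical_le_iff.mpr ?_ (hr v hv)
      rw [Ideal.span_le]
      rintro _ ⟨i, rfl⟩
      have : algebraMap F B (w i) ∈ J := Ideal.subset_span (List.mem_ofFn.mpr ⟨i, rfl⟩)
      change Ideal.Quotient.mk J _ ∈ Q
      rw [Ideal.Quotient.eq_zero_iff_mem.mpr this]
      exact Q.zero_mem
    have hmax : Q.comap (Ideal.Quotient.mk J) = maximalIdeal B := by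
      refine le_antisymm (le_maximalIdeal hQ'.ne_top) ?_
      rw [← Localization.AtPrime.map_eq_maximalIdeal]
      exact Ideal.map_le_iff_le_comap.mpr hmQ
    rw [← Ideal.map_comap_of_surjective _ Ideal.Quotient.mk_surjective Q, hmax]
    refine (Ideal.map_eq_top_or_isMaximal_of_surjective _ Ideal.Quotient.mk_surjective
      inferInstance).resolve_left fun htop => hQ.ne_top ?_
    rwa [← hmax, Ideal.map_comap_of_surjective _ Ideal.Quotient.mk_surjective] at htop
  rw [List.length_ofFn]
  calc _ ≤ (0 : WithBot ℕ∞) + s := by gcongr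
    _ ≤ _ := by rw [zero_add]; exact_mod_cast hs

end

end IsStandardGraded

/-! ### Extension of scalars to the algebraic closure. -/

section BaseChange

open TensorProduct

variable (E : Type*) [Field E] [Algebra k E]

theorem baseChange_submodule_mul (M N : Submodule k F) :
    (M * N).baseChange E = M.baseChange E * N.baseChange E := by
  simp only [Submodule.baseChange_eq_span]
  refine le_antisymm (Submodule.span_le.mpr ?_) ?_
  · rintro _ ⟨x, hx, rfl⟩
    refine Submodule.mul_induction_on hx (fun a ha b hb => ?_) fun a b ha hb => ?_
    · have : TensorProduct.mk k E F 1 (a * b) =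
          TensorProduct.mk k E F 1 a * TensorProduct.mk k E F 1 b := by
        simp
      rw [SetLike.mem_coe, this]
      exact Submodule.mul_mem_mul (Submodule.subset_span ⟨a, ha, rfl⟩)
        (Submodule.subset_span ⟨b, hb, rfl⟩)
    · rw [map_add]
      exact add_mem ha hb
  · rw [Submodule.span_mul_span, Submodule.span_le]
    rintro _ ⟨_, ⟨a, ha, rfl⟩, _, ⟨b, hb, rfl⟩, rfl⟩
    refine Submodule.subset_span ⟨a * b, Submodule.mul_mem_mul ha hb, ?_⟩
    simp

theorem baseChange_submodule_one : (1 : Submodule k F).baseChange E = 1 := by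
  rw [Submodule.one_eq_span, Submodule.baseChange_span, Submodule.one_eq_span]
  simp [Algebra.TensorProduct.one_def]

theorem baseChange_submodule_pow (M : Submodule k F) (n : ℕ) :
    (M ^ n).baseChange E = M.baseChange E ^ n := by
  induction n with
  | zero => rw [pow_zero, pow_zero, baseChange_submodule_one]
  | succ n ih => rw [pow_succ, pow_succ, baseChange_submodule_mul, ih]

theorem finrank_baseChange_submodule (M : Submodule k F) :
    Module.finrank E (M.baseChange E) = Module.finrank k M := by
  rw [← Module.finrank_baseChange (R := E) (S := k) (M' := M)]
  exact (LinearMap.finrank_range_of_inj (f := M.subtype.baseChange E)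
    (Module.Flat.lTensor_preserves_injective_linearMap (M := E) _ M.injective_subtype))

theorem IsStandardGraded.baseChange {𝒜 : ℕ → Submodule k F} (h : IsStandardGraded 𝒜) :
    IsStandardGraded fun i => (𝒜 i).baseChange E where
  eq_pow i := by rw [h.eq_pow i, baseChange_submodule_pow]
  fg := by
    obtain ⟨S, hS⟩ := h.fg
    rw [← hS, Submodule.baseChange_span]
    exact Submodule.fg_span (S.finite_toSet.image _)

attribute [local instance] Algebra.TensorProduct.rightAlgebra

instance isIntegral_rightAlgebra [Algebra.IsIntegral k E] : Algebra.IsIntegral F (E ⊗[k] F) where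
  isIntegral x := by
    induction x using TensorProduct.induction_on with
    | zero => exact isIntegral_zero
    | add x y hx hy => exact hx.add hy
    | tmul e f =>
      have h1 : e ⊗ₜ[k] f = e ⊗ₜ[k] 1 * algebraMap F (E ⊗[k] F) f := by
        rw [Algebra.TensorProduct.right_algebraMap_apply]
        simp
      rw [h1]
      refine IsIntegral.mul ?_ isIntegral_algebraMap
      have h2 : IsIntegral k e := Algebra.IsIntegral.isIntegral e
      exact (h2.map (Algebra.TensorProduct.includeLeft : E →ₐ[k] E ⊗[k] F)).tower_top

theorem flat_rightAlgebra : Module.Flat F (E ⊗[k] F) :=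
  Module.Flat.isBaseChange k F E _
    (Algebra.IsPushout.out (R := k) (S := F) (R' := E) (S' := E ⊗[k] F))

theorem faithfulSMul_rightAlgebra : FaithfulSMul F (E ⊗[k] F) :=
  (faithfulSMul_iff_algebraMap_injective _ _).mpr
    (Algebra.TensorProduct.includeRight_injective (algebraMap k E).injective)

namespace IsStandardGraded

variable {𝒜 : ℕ → Submodule k F} (h : IsStandardGraded 𝒜)
include h

theorem isNoetherianRing [GradedAlgebra 𝒜] : IsNoetherianRing F := by
  obtain ⟨s, w, hw⟩ := Submodule.fg_iff_exists_fin_generating_family.mp h.fg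
  have hfin := h.finite_aeval (w := w) (fun i => hw ▸ Submodule.subset_span ⟨i, rfl⟩) fun v hv => by
    rw [← ideal_span_submodule_span (k := k), hw]
    exact Ideal.le_radical (Ideal.subset_span hv)
  let := (aeval (R := k) w).toRingHom.toAlgebra
  have : Module.Finite (MvPolynomial (Fin s) k) F := hfin
  exact IsNoetherianRing.of_finite (MvPolynomial (Fin s) k) F

variable [GradedAlgebra 𝒜] [Nontrivial F]

theorem le_height_span_of_ringKrullDim_eq [Infinite k] {l : ℕ} (hl : ringKrullDim F = l) :
    l ≤ (Ideal.span (𝒜 1 : Set F)).height := by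
  obtain ⟨s, w, hw, hai, hr⟩ := h.exists_algebraicIndependent le_rfl
    fun v hv => Ideal.le_radical (Ideal.subset_span hv)
  have hsl : s = l := by
    have h1 := h.ringKrullDim_eq hw hr hai
    rw [hl] at h1
    exact_mod_cast h1.symm
  exact hsl ▸ h.le_height_span hw hr hai

/-- A Noether normalization chosen inside W is a regular family at the irrelevant ideal, so its span
alone already accounts for the bound. -/
theorem le_finrank_mul_add_choose [Infinite k] [(Ideal.span (𝒜 1 : Set F)).IsMaximal]
    {l : ℕ} (hl : ringKrullDim F = l)
    {W : Submodule k F} (hW : W ≤ 𝒜 1) (hr : ∀ v ∈ 𝒜 1, v ∈ (Ideal.span (W : Set F)).radical)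
    {rs : List (Localization.AtPrime (Ideal.span (𝒜 1 : Set F)))}
    (hrs : ∀ r ∈ rs, r ∈ maximalIdeal _)
    (hreg : IsRegular (Localization.AtPrime (Ideal.span (𝒜 1 : Set F))) rs)
    (hlen : l ≤ rs.length) :
    l * Module.finrank k (𝒜 1) ≤ Module.finrank k (W * 𝒜 1 : Submodule k F) + l.choose 2 := by
  obtain ⟨s, w, hwW, hai, hwr⟩ := h.exists_algebraicIndependent hW hr
  have hw (i) : w i ∈ 𝒜 1 := hW (hwW i)
  have hsl : s = l := by
    have h1 := h.ringKrullDim_eq hw hwr hai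
    rw [hl] at h1
    exact_mod_cast h1.symm
  subst hsl
  have := h.isNoetherianRing
  have hfam := isRegularFamily_of_isRegular hw hwr hrs hreg hlen
  rw [← h.finrank_span_range_mul_add_choose_of_isRegularFamily hw hai.linearIndependent hfam]
  have hle : Submodule.span k (Set.range w) ≤ W :=
    Submodule.span_le.mpr (by rintro _ ⟨i, rfl⟩; exact hwW i)
  have hWfin : FiniteDimensional k (W * 𝒜 1 : Submodule k F) :=
    Module.Finite.iff_fg.mpr ((h.fg.of_le hW).mul h.fg)
  gcongr
  exact Submodule.finrank_mono (mul_le_mul' hle le_rfl)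

theorem exists_ringKrullDim_eq : ∃ s : ℕ, ringKrullDim F = s := by
  let E := AlgebraicClosure k
  have hfaith := faithfulSMul_rightAlgebra (k := k) (F := F) E
  have : Nontrivial (E ⊗[k] F) := (FaithfulSMul.algebraMap_injective F (E ⊗[k] F)).nontrivial
  obtain ⟨s, w, hw, hai, hr⟩ := (h.baseChange E).exists_algebraicIndependent le_rfl
    fun v hv => Ideal.le_radical (Ideal.subset_span hv)
  refine ⟨s, ?_⟩
  rw [← ringKrullDim_eq_of_isIntegral (R := F) (S := E ⊗[k] F)]
  exact (h.baseChange E).ringKrullDim_eq hw hr hai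

/-- A standard graded Cohen--Macaulay algebra whose degree two component has the smallest possible
dimension has reduction number at most one. -/
theorem mul_eq_of_isCohenMacaulay (hCM : IsCohenMacaulay F) {l : ℕ} (hl : ringKrullDim F = l)
    (hΔ : Module.finrank k (𝒜 2) + l.choose 2 = l * Module.finrank k (𝒜 1))
    {W : Submodule k F} (hW : W ≤ 𝒜 1) (hr : ∀ v ∈ 𝒜 1, v ∈ (Ideal.span (W : Set F)).radical) :
    W * 𝒜 1 = 𝒜 2 := by
  -- The field k may be finite, and then W need not contain a linear system of parameters. The
  -- closure E is infinite, and the extension is flat and integral, so regular sequences and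
  -- dimension carry over.
  let E := AlgebraicClosure k
  have hfaith := faithfulSMul_rightAlgebra (k := k) (F := F) E
  have hnt : Nontrivial (E ⊗[k] F) := (FaithfulSMul.algebraMap_injective F (E ⊗[k] F)).nontrivial
  have hflat : Module.Flat F (E ⊗[k] F) := flat_rightAlgebra E
  have hE := h.baseChange E
  obtain ⟨n, hn⟩ := h.exists_mul_eq_of_mem_radical hW hr
  have hWE : W.baseChange E ≤ (𝒜 1).baseChange E := Submodule.baseChange_mono _ hW
  have hrE : W.baseChange E * (𝒜 n).baseChange E = (𝒜 (n + 1)).baseChange E := by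
    rw [← baseChange_submodule_mul, hn]
  have hlE : ringKrullDim (E ⊗[k] F) = l := by rw [ringKrullDim_eq_of_isIntegral (R := F), hl]
  have hmax := h.isMaximal_span
  have hmaxE := hE.isMaximal_span
  have hcomap : Ideal.span (𝒜 1 : Set F) =
      (Ideal.span ((𝒜 1).baseChange E : Set (E ⊗[k] F))).comap (algebraMap F (E ⊗[k] F)) := by
    refine hmax.eq_of_le (Ideal.comap_ne_top _ hmaxE.ne_top) (Ideal.span_le.mpr fun v hv => ?_)
    exact Ideal.subset_span (Submodule.tmul_mem_baseChange_of_mem (1 : E) hv)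
  -- The height bound is proved over E, where normalization is available, and descends because
  -- heights do not drop under contraction along an integral extension.
  have hheight : l ≤ (Ideal.span (𝒜 1 : Set F)).height := by
    rw [hcomap]
    exact (hE.le_height_span_of_ringKrullDim_eq hlE).trans (height_le_height_under_of_isIntegral _)
  obtain ⟨-, rs, hrs, hreg, hdim⟩ := hCM.2 (Ideal.span (𝒜 1 : Set F))
  have hlen : l ≤ rs.length := by
    rw [IsLocalization.AtPrime.ringKrullDim_eq_height (Ideal.span (𝒜 1 : Set F))
      (Localization.AtPrime (Ideal.span (𝒜 1 : Set F)))] at hdim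
    rw [← WithBot.coe_injective hdim] at hheight
    exact_mod_cast hheight
  obtain ⟨rs', hlen', hrs', hreg'⟩ := exists_isRegular_of_flat hcomap hrs hreg
  have h3 := hE.le_finrank_mul_add_choose hlE hWE (fun v hv => hE.mem_radical_of_mul_eq hrE hv)
    hrs' hreg' (hlen'.symm ▸ hlen)
  rw [← baseChange_submodule_mul, finrank_baseChange_submodule, finrank_baseChange_submodule] at h3
  have h2 : 𝒜 2 = 𝒜 1 * 𝒜 1 := h.add_one 1
  have := h.finiteDimensional 2
  have hWle : W * 𝒜 1 ≤ 𝒜 2 := h2 ▸ mul_le_mul' hW le_rfl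
  refine Submodule.eq_of_le_of_finrank_le hWle ?_
  omega

end IsStandardGraded

end BaseChange

end FreimanIdeal

/-! ### The fiber ring of an ideal and its grading. -/

namespace FreimanIdeal

open IsLocalRing RingTheory.Sequence
open scoped Pointwise

section FiberRing

variable {R k F : Type*} [CommRing R] [Field k] [CommRing F] [Algebra R k] [Algebra k F]
  [Algebra R F] [IsScalarTower R k F] {m A : Ideal R}

/-- With `reesMonomial_mem_map` this identifies the degree i part of the extension of m to the Rees
algebra with m A^i. -/
theorem coeff_mem_of_mem_map {x : reesAlgebra A} (hx : x ∈ m.map (algebraMap R (reesAlgebra A)))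
    (i : ℕ) : (x : Polynomial R).coeff i ∈ m * A ^ i := by
  suffices ∀ y : reesAlgebra A, ((y * x : reesAlgebra A) : Polynomial R).coeff i ∈ m * A ^ i by
    simpa using this 1
  rw [Ideal.map] at hx
  induction hx using Submodule.span_induction with
  | mem x hx =>
    obtain ⟨r, hr, rfl⟩ := hx
    intro y
    change ((y : Polynomial R) * Polynomial.C r).coeff i ∈ _
    rw [Polynomial.coeff_mul_C, mul_comm _ r]
    exact Ideal.mul_mem_mul hr (y.2 i)
  | zero => simp
  | add x z _ _ hx hz =>
    intro y
    rw [mul_add, Subalgebra.coe_add, Polynomial.coeff_add]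
    exact Ideal.add_mem _ (hx y) (hz y)
  | smul a x _ hx =>
    intro y
    rw [smul_eq_mul, ← mul_assoc]
    exact hx _

/-- The inclusion of `A ^ n` in the Rees algebra in degree `n`. -/
noncomputable def reesMonomial (A : Ideal R) (n : ℕ) : ↥(A ^ n) →ₗ[R] reesAlgebra A where
  toFun a := ⟨Polynomial.monomial n (a : R), reesAlgebra.monomial_mem.mpr a.2⟩
  map_add' a b := by ext1; simp
  map_smul' r a := by ext1; simp [Polynomial.smul_monomial]

theorem coe_reesMonomial {n : ℕ} (a : ↥(A ^ n)) :
    (reesMonomial A n a : Polynomial R) = Polynomial.monomial n (a : R) := rfl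

theorem reesMonomial_mul {n p : ℕ} (a : ↥(A ^ n)) (b : ↥(A ^ p)) :
    reesMonomial A n a * reesMonomial A p b =
      reesMonomial A (n + p) ⟨a * b, pow_add A n p ▸ Ideal.mul_mem_mul a.2 b.2⟩ :=
  Subtype.ext (Polynomial.monomial_mul_monomial _ _ _ _)

theorem sum_reesMonomial (x : reesAlgebra A) :
    ∑ i ∈ (x : Polynomial R).support, reesMonomial A i ⟨(x : Polynomial R).coeff i, x.2 i⟩ = x := by
  ext1
  rw [AddSubmonoidClass.coe_finsetSum]
  exact (x : Polynomial R).as_sum_support.symm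

theorem reesMonomial_mem_map {n : ℕ} (a : ↥(A ^ n)) (ha : (a : R) ∈ m * A ^ n) :
    reesMonomial A n a ∈ m.map (algebraMap R (reesAlgebra A)) := by
  have key : m * A ^ n ≤ ((((m.map (algebraMap R (reesAlgebra A))).restrictScalars R).comap
      (reesMonomial A n)).map (A ^ n).subtype : Ideal R) := by
    refine Submodule.mul_le.mpr fun r hr b hb => ⟨r • ⟨b, hb⟩, ?_, rfl⟩
    change reesMonomial A n (r • ⟨b, hb⟩) ∈ m.map (algebraMap R (reesAlgebra A))
    rw [map_smul, Algebra.smul_def]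
    exact Ideal.mul_mem_right _ _ (Ideal.mem_map_of_mem _ hr)
  obtain ⟨b, hb, hab⟩ := key ha
  rwa [← Subtype.ext hab]

/-- `π` presents `F` as the fiber ring `⨁ₖ A ^ k / m A ^ k`, and `k` is the residue field of `m`. -/
structure IsFiberMap (k : Type*) [Field k] [Algebra R k] (m : Ideal R) (π : reesAlgebra A →ₐ[R] F) :
    Prop where
  surjective : Function.Surjective π
  ker_eq : RingHom.ker π = m.map (algebraMap R (reesAlgebra A))
  surjective_algebraMap : Function.Surjective (algebraMap R k)

namespace IsFiberMap

variable {π : reesAlgebra A →ₐ[R] F} (h : IsFiberMap k m π)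

/-- The class of an element of `A ^ n` in the fiber ring. -/
noncomputable def cls (π : reesAlgebra A →ₐ[R] F) (n : ℕ) : ↥(A ^ n) →ₗ[R] F :=
  π.toLinearMap ∘ₗ reesMonomial A n

theorem cls_mul {n p : ℕ} (a : ↥(A ^ n)) (b : ↥(A ^ p)) :
    cls π n a * cls π p b =
      cls π (n + p) ⟨a * b, pow_add A n p ▸ Ideal.mul_mem_mul a.2 b.2⟩ := by
  change π _ * π _ = π _
  rw [← map_mul, reesMonomial_mul]

include h in
omit [Algebra k F] [IsScalarTower R k F] in
theorem map_eq_zero_iff (x : reesAlgebra A) :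
    π x = 0 ↔ x ∈ m.map (algebraMap R (reesAlgebra A)) := by
  rw [← h.ker_eq]
  rfl

include h in
omit [Algebra k F] [IsScalarTower R k F] in
theorem cls_eq_zero_iff {n : ℕ} (a : ↥(A ^ n)) : cls π n a = 0 ↔ (a : R) ∈ m * A ^ n := by
  refine (h.map_eq_zero_iff _).trans ⟨fun h => ?_, reesMonomial_mem_map a⟩
  simpa [coe_reesMonomial] using coeff_mem_of_mem_map h n

/-- The image in degree `n` of the fiber ring of an ideal `N` (intersected with `A ^ n`). -/
noncomputable def piece (n : ℕ) (N : Ideal R) : Submodule k F where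
  carrier := {x | ∃ a : ↥(A ^ n), (a : R) ∈ N ∧ cls π n a = x}
  add_mem' := by
    rintro _ _ ⟨a, ha, rfl⟩ ⟨b, hb, rfl⟩
    exact ⟨a + b, N.add_mem ha hb, map_add _ _ _⟩
  zero_mem' := ⟨0, N.zero_mem, map_zero _⟩
  smul_mem' := by
    rintro c _ ⟨a, ha, rfl⟩
    obtain ⟨r, rfl⟩ := h.surjective_algebraMap c
    exact ⟨r • a, N.mul_mem_left r ha, by rw [map_smul, algebraMap_smul]⟩

theorem cls_mem_piece {n : ℕ} {N : Ideal R} (a : ↥(A ^ n)) (ha : (a : R) ∈ N) :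
    cls π n a ∈ h.piece n N := ⟨a, ha, rfl⟩

theorem piece_mono {n : ℕ} {N N' : Ideal R} (hN : N ≤ N') : h.piece n N ≤ h.piece n N' := by
  rintro _ ⟨a, ha, rfl⟩
  exact ⟨a, hN ha, rfl⟩

/-- The class map in degree n has kernel m A^n, so images compare exactly up to that ideal. This is
the form in which Nakayama is applied. -/
theorem piece_le_piece_iff {n : ℕ} {N N' : Ideal R} (hN : N ≤ A ^ n) (hN' : N' ≤ A ^ n) :
    h.piece n N ≤ h.piece n N' ↔ N ≤ N' ⊔ m * A ^ n := by
  constructor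
  · intro hle x hx
    obtain ⟨b, hb, hbx⟩ := hle (h.cls_mem_piece ⟨x, hN hx⟩ hx)
    rw [← sub_eq_zero, ← map_sub, h.cls_eq_zero_iff] at hbx
    have h1 : (b : R) - x ∈ m * A ^ n := hbx
    have h2 : x = b + -((b : R) - x) := by ring
    rw [h2]
    exact Submodule.add_mem_sup hb (neg_mem h1)
  · rintro hle _ ⟨a, ha, rfl⟩
    obtain ⟨b, hb, c, hc, hbc⟩ := Submodule.mem_sup.mp (hle ha)
    refine ⟨⟨b, hN' hb⟩, hb, ?_⟩
    rw [← sub_eq_zero, ← map_sub, h.cls_eq_zero_iff]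
    change b - (a : R) ∈ _
    rw [← hbc, sub_add_cancel_left]
    exact neg_mem hc

theorem piece_mul {n p : ℕ} {N M : Ideal R} (hN : N ≤ A ^ n) (hM : M ≤ A ^ p) :
    h.piece n N * h.piece p M = h.piece (n + p) (N * M) := by
  refine le_antisymm (Submodule.mul_le.mpr ?_) ?_
  · rintro _ ⟨a, ha, rfl⟩ _ ⟨b, hb, rfl⟩
    rw [cls_mul]
    exact h.cls_mem_piece _ (Ideal.mul_mem_mul ha hb)
  · rintro _ ⟨⟨x, hx'⟩, hx, rfl⟩
    have key : N * M ≤ ((((h.piece n N * h.piece p M).restrictScalars R).comap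
        (cls π (n + p))).map (A ^ (n + p)).subtype : Ideal R) := by
      refine Submodule.mul_le.mpr fun a ha b hb =>
        ⟨⟨a * b, pow_add A n p ▸ Ideal.mul_mem_mul (hN ha) (hM hb)⟩, ?_, rfl⟩
      have := Submodule.mul_mem_mul (h.cls_mem_piece ⟨a, hN ha⟩ ha)
        (h.cls_mem_piece ⟨b, hM hb⟩ hb)
      rwa [cls_mul] at this
    obtain ⟨b, hb, hab⟩ := key hx
    have : b = ⟨x, hx'⟩ := Subtype.ext hab
    rwa [← this]

theorem piece_zero_top : h.piece 0 ⊤ = 1 := by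
  ext x
  rw [Submodule.mem_one]
  have key (a : ↥(A ^ 0)) : cls π 0 a = algebraMap R F a := by
    rw [← π.commutes]
    rfl
  constructor
  · rintro ⟨a, -, rfl⟩
    exact ⟨algebraMap R k a, by rw [key, IsScalarTower.algebraMap_apply R k F]⟩
  · rintro ⟨c, rfl⟩
    obtain ⟨r, rfl⟩ := h.surjective_algebraMap c
    refine ⟨⟨r, by simp⟩, trivial, ?_⟩
    rw [key, IsScalarTower.algebraMap_apply R k F]

/-- The component of degree `n` of the fiber ring. -/
noncomputable def component (n : ℕ) : Submodule k F := h.piece n (A ^ n)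

theorem cls_mem_component {n : ℕ} (a : ↥(A ^ n)) : cls π n a ∈ h.component n :=
  h.cls_mem_piece a a.2

theorem component_zero : h.component 0 = 1 := by
  rw [component, pow_zero, Ideal.one_eq_top, piece_zero_top]

theorem component_add (n p : ℕ) : h.component (n + p) = h.component n * h.component p := by
  rw [component, component, component, piece_mul _ le_rfl le_rfl, pow_add]

theorem component_eq_pow (n : ℕ) : h.component n = h.component 1 ^ n := by
  induction n with
  | zero => rw [component_zero, pow_zero]
  | succ n ih => rw [component_add, pow_succ, ih]

/-- Independence: a sum of classes from other degrees lifts to an element with no coefficient in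
degree n, and the kernel is controlled coefficientwise. -/
theorem isInternal_component : DirectSum.IsInternal h.component := by
  rw [DirectSum.isInternal_submodule_iff_iSupIndep_and_iSup_eq_top]
  constructor
  · rw [iSupIndep_def]
    intro n
    rw [Submodule.disjoint_def]
    rintro _ ⟨a, -, rfl⟩ ha
    have key : ∀ x ∈ ⨆ j, ⨆ (_ : j ≠ n), h.component j, ∃ y : reesAlgebra A,
        π y = x ∧ (y : Polynomial R).coeff n = 0 := by
      intro x hx
      rw [iSup_subtype'] at hx
      refine Submodule.iSup_induction _ (motive := fun x => ∃ y : reesAlgebra A,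
        π y = x ∧ (y : Polynomial R).coeff n = 0) hx ?_ ⟨0, map_zero _, rfl⟩ ?_
      · rintro j _ ⟨b, -, rfl⟩
        exact ⟨_, rfl, Polynomial.coeff_monomial_of_ne _ j.2.symm⟩
      · rintro _ _ ⟨x, rfl, hx⟩ ⟨y, rfl, hy⟩
        exact ⟨x + y, map_add _ _ _, by simp [hx, hy]⟩
    obtain ⟨y, hya, hy⟩ := key _ ha
    have hya' : π (y - reesMonomial A n a) = 0 := by rw [map_sub, hya]; exact sub_self _
    have := coeff_mem_of_mem_map ((h.map_eq_zero_iff _).mp hya') n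
    rw [h.cls_eq_zero_iff, ← neg_mem_iff]
    simpa [hy, coe_reesMonomial] using this
  · rw [eq_top_iff]
    intro x _
    obtain ⟨x, rfl⟩ := h.surjective x
    rw [← sum_reesMonomial x, map_sum]
    exact Submodule.sum_mem _ fun i _ => Submodule.mem_iSup_of_mem i (h.cls_mem_component _)

/-- The grading of the fiber ring. -/
noncomputable abbrev gradedAlgebra : GradedAlgebra h.component where
  one_mem := by
    rw [component_zero]
    exact Submodule.one_le.mp le_rfl
  mul_mem i j _ _ hx hy := by
    rw [component_add]
    exact Submodule.mul_mem_mul hx hy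
  toDecomposition := h.isInternal_component.chooseDecomposition

theorem piece_span (n : ℕ) {S : Set R} (hS : S ⊆ (A ^ n : Ideal R)) :
    h.piece n (Ideal.span S) =
      Submodule.span k {x | ∃ a, ∃ ha : a ∈ S, cls π n ⟨a, hS ha⟩ = x} := by
  refine le_antisymm ?_ (Submodule.span_le.mpr ?_)
  · rintro _ ⟨⟨x, hx'⟩, hx, rfl⟩
    have key : Ideal.span S ≤ ((((Submodule.span k {x | ∃ a, ∃ ha : a ∈ S,
        cls π n ⟨a, hS ha⟩ = x}).restrictScalars R).comap
          (cls π n)).map (A ^ n).subtype : Ideal R) :=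
      Ideal.span_le.mpr fun a ha => ⟨⟨a, hS ha⟩, Submodule.subset_span ⟨a, ha, rfl⟩, rfl⟩
    obtain ⟨b, hb, hab⟩ := key hx
    have : b = ⟨x, hx'⟩ := Subtype.ext hab
    rwa [← this]
  · rintro _ ⟨a, ha, rfl⟩
    exact h.cls_mem_piece _ (Ideal.subset_span ha)

theorem isStandardGraded (hA : A.FG) : IsStandardGraded h.component where
  eq_pow := h.component_eq_pow
  fg := by
    obtain ⟨S, hS⟩ := hA
    have hSA : (S : Set R) ⊆ (A ^ 1 : Ideal R) := by
      rw [pow_one, ← hS]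
      exact Ideal.subset_span
    have h1 := h.piece_span 1 hSA
    rw [show Ideal.span (S : Set R) = A ^ 1 by rw [pow_one, ← hS]] at h1
    rw [component, h1]
    refine Submodule.fg_span (((Set.finite_univ (α := S)).image
      (fun a : S => cls π 1 ⟨a, hSA a.2⟩)).subset ?_)
    rintro _ ⟨a, ha, rfl⟩
    exact ⟨⟨a, ha⟩, trivial, rfl⟩

end IsFiberMap

end FiberRing

end FreimanIdeal

/-! ### Generators and reductions of a local ideal, read off in the fiber ring. -/

namespace FreimanIdeal

open IsLocalRing RingTheory.Sequence
open scoped Pointwise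

theorem nontrivial_of_ringKrullDim_eq {F : Type*} [CommRing F] {l : ℕ} (hl : ringKrullDim F = l) :
    Nontrivial F := by
  rw [← not_subsingleton_iff_nontrivial]
  intro hF
  rw [ringKrullDim_eq_bot_of_subsingleton] at hl
  exact WithBot.natCast_ne_bot l hl.symm

namespace IsFiberMap

variable {R k F : Type*} [CommRing R] [IsLocalRing R] [IsNoetherianRing R] [Field k] [CommRing F]
  [Algebra R k] [Algebra k F] [Algebra R F] [IsScalarTower R k F] {A : Ideal R}
  {π : reesAlgebra A →ₐ[R] F} (h : IsFiberMap k (maximalIdeal R) π)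

omit [IsNoetherianRing R] in
theorem algebraMap_eq_zero_imp {r : R} (hr : algebraMap R k r = 0) : r ∈ maximalIdeal R := by
  rw [mem_maximalIdeal, mem_nonunits_iff]
  intro hu
  exact (hu.map (algebraMap R k)).ne_zero hr

theorem eq_pow_of_component_le {n : ℕ} {N : Ideal R} (hN : N ≤ A ^ n)
    (hle : h.component n ≤ h.piece n N) : N = A ^ n := by
  refine le_antisymm hN ?_
  have := (h.piece_le_piece_iff le_rfl hN).mp hle
  exact Submodule.le_of_le_smul_of_le_jacobson_bot (IsNoetherian.noetherian _)
    (maximalIdeal_le_jacobson _) this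

theorem finrank_component (n : ℕ) :
    Module.finrank k (h.component n) = Submodule.spanFinrank (A ^ n) := by
  have hfg : (A ^ n).FG := IsNoetherian.noetherian _
  have hSG := h.isStandardGraded (IsNoetherian.noetherian A)
  have := hSG.finiteDimensional n
  apply le_antisymm
  · have hS := Submodule.FG.finite_generators hfg
    have hspan : Ideal.span (A ^ n).generators = A ^ n := (A ^ n).span_generators
    have hsub : (A ^ n).generators ⊆ (A ^ n : Ideal R) := by
      nth_rw 2 [← hspan]
      exact Ideal.subset_span
    have h1 := h.piece_span n hsub
    rw [hspan] at h1
    rw [component, h1, ← Submodule.FG.generators_ncard hfg]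
    have : Fintype (A ^ n).generators := hS.fintype
    have h2 : {x | ∃ a, ∃ ha : a ∈ (A ^ n).generators, cls π n ⟨a, hsub ha⟩ = x} =
        Set.range fun a : (A ^ n).generators => cls π n ⟨a, hsub a.2⟩ := by
      ext x
      simp
    rw [h2, ← Nat.card_coe_set_eq, Nat.card_eq_fintype_card]
    exact finrank_range_le_card _
  · let b := Module.finBasis k (h.component n)
    have hb (i) : ∃ a : ↥(A ^ n), cls π n a = b i := by
      obtain ⟨a, -, ha⟩ := (b i).2
      exact ⟨a, ha⟩
    choose a ha using hb
    have hsub : Set.range (fun i => (a i : R)) ⊆ (A ^ n : Ideal R) := by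
      rintro _ ⟨i, rfl⟩
      exact (a i).2
    have h1 : Ideal.span (Set.range fun i => (a i : R)) = A ^ n := by
      refine h.eq_pow_of_component_le (Ideal.span_le.mpr hsub) ?_
      rw [h.piece_span n hsub]
      intro x hx
      have := b.mem_span ⟨x, hx⟩
      rw [← (Submodule.map_subtype_top (h.component n)), ← b.span_eq, Submodule.map_span] at hx
      refine Submodule.span_mono ?_ hx
      rintro _ ⟨_, ⟨i, rfl⟩, rfl⟩
      exact ⟨a i, ⟨i, rfl⟩, ha i⟩
    rw [← h1]
    refine (Submodule.spanFinrank_span_le_ncard_of_finite (Set.finite_range _)).trans ?_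
    rw [← Set.image_univ]
    refine (Set.ncard_image_le Set.finite_univ).trans ?_
    rw [Set.ncard_univ, Nat.card_eq_fintype_card, Fintype.card_fin]

theorem mul_pow_eq_iff {J : Ideal R} (hJ : J ≤ A) (n : ℕ) :
    A ^ (n + 1) = J * A ^ n ↔ h.piece 1 J * h.component n = h.component (n + 1) := by
  have hJ1 : J ≤ A ^ 1 := by rwa [pow_one]
  rw [component, h.piece_mul hJ1 le_rfl, add_comm 1 n]
  refine ⟨fun hA => by rw [← hA, component], fun hA => (h.eq_pow_of_component_le ?_ hA.ge).symm⟩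
  rw [pow_succ']
  exact Ideal.mul_mono hJ le_rfl

omit [IsNoetherianRing R] in
theorem piece_one_le {J : Ideal R} (hJ : J ≤ A) : h.piece 1 J ≤ h.component 1 :=
  h.piece_mono (by rwa [pow_one])

/-- Being a reduction depends only on the image of J in degree one, which allows J to be replaced by
an ideal generated by lifts of chosen linear forms. -/
theorem isReduction_iff {J : Ideal R} (hJ : J ≤ A) : IsReduction J A ↔
    ∀ v ∈ h.component 1, v ∈ (Ideal.span (h.piece 1 J : Set F)).radical := by
  have hSG := h.isStandardGraded (IsNoetherian.noetherian A)
  let := h.gradedAlgebra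
  constructor
  · rintro ⟨-, n, hn⟩ v hv
    exact hSG.mem_radical_of_mul_eq ((h.mul_pow_eq_iff hJ n).mp hn) hv
  · intro hr
    obtain ⟨n, hn⟩ := hSG.exists_mul_eq_of_mem_radical (h.piece_one_le hJ) hr
    exact ⟨hJ, n, (h.mul_pow_eq_iff hJ n).mpr hn⟩

omit [IsNoetherianRing R] [IsLocalRing R] in
theorem exists_lift {m : Ideal R} (h : IsFiberMap k m π) {J : Ideal R} {s : ℕ} {w : Fin s → F}
    (hw : ∀ i, w i ∈ h.piece 1 J) : ∃ x : Fin s → ↥(A ^ 1), (∀ i, (x i : R) ∈ J) ∧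
      (∀ i, cls π 1 (x i) = w i) ∧ h.piece 1 (Ideal.span (Set.range fun i => (x i : R))) =
        Submodule.span k (Set.range w) := by
  choose x hxJ hxw using hw
  refine ⟨x, hxJ, hxw, ?_⟩
  have hsub : (Set.range fun i => (x i : R)) ⊆ (A ^ 1 : Ideal R) := by
    rintro _ ⟨i, rfl⟩
    exact (x i).2
  rw [h.piece_span 1 hsub]
  congr 1
  ext y
  constructor
  · rintro ⟨_, ⟨i, rfl⟩, rfl⟩
    exact ⟨i, (hxw i).symm⟩
  · rintro ⟨i, rfl⟩
    exact ⟨x i, ⟨i, rfl⟩, hxw i⟩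

/-- An ideal generated by lifts of linearly independent forms is determined by the forms. -/
theorem eq_span_of_piece_le {s : ℕ} {x : Fin s → ↥(A ^ 1)}
    (hli : LinearIndependent k fun i => cls π 1 (x i)) {J : Ideal R}
    (hJ : J ≤ Ideal.span (Set.range fun i => (x i : R)))
    (hle : h.piece 1 (Ideal.span (Set.range fun i => (x i : R))) ≤ h.piece 1 J) :
    J = Ideal.span (Set.range fun i => (x i : R)) := by
  refine le_antisymm hJ ?_
  set L := Ideal.span (Set.range fun i => (x i : R)) with hL
  have hLA : L ≤ A ^ 1 := Ideal.span_le.mpr (by rintro _ ⟨i, rfl⟩; exact (x i).2)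
  rw [h.piece_le_piece_iff hLA (hJ.trans hLA)] at hle
  have key : L ≤ J ⊔ maximalIdeal R • L := by
    intro z hz
    obtain ⟨j, hj, y, hy, rfl⟩ := Submodule.mem_sup.mp (hle hz)
    -- The error y lies in 𝔪A and in L. Writing it in the generators of L, independence of their
    -- classes forces the coefficients into 𝔪, so y is in 𝔪L and Nakayama applies to L itself.
    refine Submodule.add_mem_sup hj ?_
    have hyL : y ∈ L := by
      have := L.sub_mem hz (hJ hj)
      rwa [add_sub_cancel_left] at this
    obtain ⟨c, hc⟩ := (Submodule.mem_span_range_iff_exists_fun R).mp hyL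
    have h0 : cls π 1 (∑ i, c i • x i) = 0 := by
      rw [h.cls_eq_zero_iff]
      have : ((∑ i, c i • x i : ↥(A ^ 1)) : R) = y := by
        rw [← hc]
        simp
      rwa [this]
    rw [map_sum] at h0
    simp_rw [map_smul, ← algebraMap_smul k (c _)] at h0
    have hc0 := Fintype.linearIndependent_iff.mp hli _ h0
    rw [← hc]
    exact Ideal.sum_mem _ fun i _ => Submodule.smul_mem_smul
      (algebraMap_eq_zero_imp (hc0 i)) (Ideal.subset_span ⟨i, rfl⟩)
  exact Submodule.le_of_le_smul_of_le_jacobson_bot (IsNoetherian.noetherian _)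
    (maximalIdeal_le_jacobson _) key

include h in
-- Take a reduction whose image in degree one has least dimension, and lift a basis of that image:
-- the lifts generate a reduction with none strictly inside. No infinite residue field is needed.
theorem exists_isMinimalReduction : ∃ J, IsMinimalReduction J A := by
  have hSG := h.isStandardGraded (IsNoetherian.noetherian A)
  have hfin := hSG.finiteDimensional 1
  let d : {J : Ideal R // IsReduction J A} → ℕ := fun J => Module.finrank k (h.piece 1 J.1)
  have hne : Nonempty {J : Ideal R // IsReduction J A} := ⟨⟨A, le_rfl, 0, by simp⟩⟩
  obtain ⟨⟨J, hJ⟩, hmin⟩ : ∃ J, ∀ J', d J ≤ d J' := ⟨Function.argmin d, fun J' =>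
    Function.argmin_le d J'⟩
  have hfinJ : FiniteDimensional k (h.piece 1 J) :=
    Submodule.finiteDimensional_of_le (h.piece_one_le hJ.1)
  let b := Module.finBasis k (h.piece 1 J)
  obtain ⟨x, hxJ, hxw, hspan⟩ := h.exists_lift (J := J) (w := fun i => (b i : F)) fun i => (b i).2
  have hb : Submodule.span k (Set.range fun i => (b i : F)) = h.piece 1 J := by
    have := congrArg (Submodule.map (h.piece 1 J).subtype) b.span_eq
    rwa [Submodule.map_span, Submodule.map_subtype_top, ← Set.range_comp] at this
  rw [hb] at hspan
  have hli : LinearIndependent k fun i => cls π 1 (x i) := by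
    simp_rw [hxw]
    exact b.linearIndependent.map' _ (Submodule.ker_subtype _)
  have hle : Ideal.span (Set.range fun i => (x i : R)) ≤ A := by
    refine Ideal.span_le.mpr ?_
    rintro _ ⟨i, rfl⟩
    exact hJ.1 (hxJ i)
  refine ⟨Ideal.span (Set.range fun i => (x i : R)), ?_, fun J' hJ' hlt => ?_⟩
  · rw [h.isReduction_iff hle, hspan, ← h.isReduction_iff hJ.1]
    exact hJ
  · refine hlt.ne (h.eq_span_of_piece_le hli hlt.le ?_)
    rw [hspan]
    have h1 : h.piece 1 J' ≤ h.piece 1 J := hspan ▸ h.piece_mono hlt.le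
    exact (Submodule.eq_of_le_of_finrank_le h1 (hmin ⟨J', hJ'⟩)).ge

include h in
theorem reductionNumber_le_one (hCM : IsCohenMacaulay F) {l : ℕ} (hl : ringKrullDim F = l)
    (hΔ : Submodule.spanFinrank (A ^ 2) + l.choose 2 = l * Submodule.spanFinrank A) :
    reductionNumber A ≤ 1 := by
  have hSG := h.isStandardGraded (IsNoetherian.noetherian A)
  let := h.gradedAlgebra
  have : Nontrivial F := nontrivial_of_ringKrullDim_eq hl
  obtain ⟨J, hJ⟩ := h.exists_isMinimalReduction
  have hJA := hJ.1.1
  have hmul := hSG.mul_eq_of_isCohenMacaulay hCM hl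
    (by rw [h.finrank_component, h.finrank_component, pow_one, hΔ]) (h.piece_one_le hJA)
    ((h.isReduction_iff hJA).mp hJ.1)
  have h1 := (h.mul_pow_eq_iff hJA 1).mpr hmul
  exact (iInf₂_le J hJ).trans (iInf₂_le 1 h1)

include h in
theorem one_le_reductionNumber [Infinite k] {l : ℕ} (hl : ringKrullDim F = l)
    (hne : Submodule.spanFinrank A ≠ l) : 1 ≤ reductionNumber A := by
  have hSG := h.isStandardGraded (IsNoetherian.noetherian A)
  let := h.gradedAlgebra
  have : Nontrivial F := nontrivial_of_ringKrullDim_eq hl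
  refine le_iInf₂ fun J hJ => le_iInf₂ fun i hi => ?_
  obtain _ | i := i
  swap
  · exact_mod_cast Nat.le_add_left 1 i
  exfalso
  -- Reduction number zero means that A is its own minimal reduction. The lifted Noether
  -- normalization generates a reduction inside A, hence all of A, which forces μ = ℓ.
  have hJA : J = A := by simpa using hi.symm
  subst hJA
  obtain ⟨s, w, hw, hai, hr⟩ := hSG.exists_algebraicIndependent le_rfl
    fun v hv => Ideal.le_radical (Ideal.subset_span hv)
  obtain ⟨x, hxJ, hxw, hspan⟩ := h.exists_lift hw
  have hle : Ideal.span (Set.range fun i => (x i : R)) ≤ J := by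
    refine Ideal.span_le.mpr ?_
    rintro _ ⟨i, rfl⟩
    exact (pow_one J).le (x i).2
  have hred : IsReduction (Ideal.span (Set.range fun i => (x i : R))) J := by
    rw [h.isReduction_iff hle, hspan, ideal_span_submodule_span]
    exact hr
  have heq := (hle.lt_or_eq).resolve_left (hJ.2 _ hred)
  rw [heq] at hspan
  have h1 : h.component 1 = Submodule.span k (Set.range w) := by
    rw [← hspan, component, pow_one]
  have h2 := h.finrank_component 1
  rw [h1, pow_one, finrank_span_eq_card hai.linearIndependent, Fintype.card_fin] at h2
  have h3 := hSG.ringKrullDim_eq hw hr hai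
  rw [hl] at h3
  have h4 : l = s := by exact_mod_cast h3
  exact hne (h2.symm.trans h4.symm)

end IsFiberMap

end FreimanIdeal

/-! ### Consequences of flatness over a normalization, and a freeness criterion. -/

namespace FreimanIdeal

open IsLocalRing RingTheory.Sequence
open scoped Pointwise

open MvPolynomial (aeval)

namespace IsStandardGraded

variable {k F : Type*} [Field k] [CommRing F] [Algebra k F] {𝒜 : ℕ → Submodule k F}
  (h : IsStandardGraded 𝒜) [GradedAlgebra 𝒜] {s : ℕ} {w : Fin s → F} (hw : ∀ i, w i ∈ 𝒜 1)

include h hw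

theorem isCohenMacaulay_of_flat (hr : ∀ v ∈ 𝒜 1, v ∈ (Ideal.span (Set.range w)).radical)
    (hai : AlgebraicIndependent k w) (hflat : (aeval (R := k) w).toRingHom.Flat) :
    IsCohenMacaulay F := by
  have hnoeth := h.isNoetherianRing
  have hdim := h.ringKrullDim_eq hw hr hai
  let := (aeval (R := k) w).toRingHom.toAlgebra
  have : Module.Flat (MvPolynomial (Fin s) k) F := hflat
  have : IsScalarTower k (MvPolynomial (Fin s) k) F :=
    .of_algebraMap_eq fun x => ((aeval (R := k) w).commutes x).symm
  have : Module.Finite (MvPolynomial (Fin s) k) F := h.finite_aeval hw hr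
  have hft : Algebra.FiniteType k F :=
    Algebra.FiniteType.trans (S := MvPolynomial (Fin s) k) inferInstance inferInstance
  refine ⟨hnoeth, fun p hp => ⟨inferInstance, ?_⟩⟩
  have hfin : Module.Finite k (F ⧸ p) := by
    let := Ideal.Quotient.field p
    exact finite_of_finite_type_of_isJacobsonRing k (F ⧸ p)
  -- F/p is finite over k by the Nullstellensatz, so each w_i is algebraic modulo p. The resulting
  -- monic polynomials give a regular sequence of length s inside an arbitrary maximal ideal p.
  have hint (i : Fin s) : ∃ f : Polynomial k, f.Monic ∧ Polynomial.aeval (w i) f ∈ p := by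
    obtain ⟨f, hf, hfw⟩ := Algebra.IsIntegral.isIntegral (R := k) (Ideal.Quotient.mk p (w i))
    refine ⟨f, hf, ?_⟩
    rw [← Ideal.Quotient.eq_zero_iff_mem, ← Ideal.Quotient.mkₐ_eq_mk k,
      ← Polynomial.aeval_algHom_apply]
    exact hfw
  choose f hf hfw using hint
  have hreg := (isWeaklyRegular_aeval_X_of_monic s f hf).of_flat (S := F)
  have hmem : ∀ r ∈ (List.ofFn fun i : Fin s => Polynomial.aeval
      (MvPolynomial.X i.rev : MvPolynomial (Fin s) k) (f i.rev)).map (algebraMap _ F), r ∈ p := by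
    intro r hr
    obtain ⟨q, hq, rfl⟩ := List.mem_map.mp hr
    obtain ⟨i, rfl⟩ := List.mem_ofFn.mp hq
    change aeval w (Polynomial.aeval _ _) ∈ p
    rw [← Polynomial.aeval_algHom_apply, MvPolynomial.aeval_X]
    exact hfw _
  have hle := length_le_height_of_isWeaklyRegular p hreg hmem
  refine ⟨_, ?_, hreg.isRegular_of_isLocalization_of_mem (Localization.AtPrime p) p hmem, ?_⟩
  · intro r hr
    obtain ⟨q, hq, rfl⟩ := List.mem_map.mp hr
    exact (IsLocalization.AtPrime.to_map_mem_maximal_iff _ p _).mpr (hmem q hq)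
  · rw [IsLocalization.AtPrime.ringKrullDim_eq_height p (Localization.AtPrime p)]
    refine congrArg _ (le_antisymm ?_ ?_)
    · rwa [List.length_map]
    · have h1 := Ideal.height_le_ringKrullDim_of_ne_top hp.ne_top
      rw [hdim] at h1
      simp only [List.length_map, List.length_ofFn]
      exact_mod_cast h1

theorem finrank_add_choose_of_flat (hai : AlgebraicIndependent k w)
    (hflat : (aeval (R := k) w).toRingHom.Flat) :
    Module.finrank k (Submodule.span k (Set.range w) * 𝒜 1 : Submodule k F) + s.choose 2 =
      s * Module.finrank k (𝒜 1) := by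
  let := (aeval (R := k) w).toRingHom.toAlgebra
  have : Module.Flat (MvPolynomial (Fin s) k) F := hflat
  have hreg := (isWeaklyRegular_aeval_X_of_monic s (fun _ => (Polynomial.X : Polynomial k))
    fun _ => Polynomial.monic_X).of_flat (S := F)
  rw [List.map_ofFn] at hreg
  have hfun : (algebraMap (MvPolynomial (Fin s) k) F) ∘ (fun i : Fin s => Polynomial.aeval
      (MvPolynomial.X i.rev : MvPolynomial (Fin s) k) (Polynomial.X : Polynomial k)) =
        w ∘ Fin.rev := by
    ext i
    simp only [Function.comp_apply, Polynomial.aeval_X]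
    exact MvPolynomial.aeval_X w _
  rw [hfun, isWeaklyRegular_ofFn_iff] at hreg
  have := h.finiteDimensional 1
  have key := finrank_span_range_mul_add_choose (w ∘ Fin.rev)
    (hai.linearIndependent.comp _ Fin.rev_injective) (fun i => hw _) fun i a ha hai' => by
      have h1 := hreg i a hai'
      rw [← ideal_span_submodule_span (k := k)] at h1
      refine h.mem_of_mem_span (Submodule.span_le.mpr ?_) h1 ha
      rintro _ ⟨j, -, rfl⟩
      exact hw _
  rwa [Fin.rev_surjective.range_comp] at key

/-- F is in fact free, with basis 1 and the y_j: degree two equal to W F_1 gives generation in all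
degrees, and independence need only be checked on homogeneous relations. -/
theorem flat_aeval_of_forall_isHomogeneous {ι : Type*} [Fintype ι] {y : ι → F}
    (hy : ∀ j, y j ∈ 𝒜 1)
    (hmul : Submodule.span k (Set.range w) * 𝒜 1 = 𝒜 2)
    (hspan : 𝒜 1 ≤ Submodule.span k (Set.range w) ⊔ Submodule.span k (Set.range y))
    (hai : AlgebraicIndependent k w)
    (hind : ∀ (d : ℕ) (g₀ : MvPolynomial (Fin s) k) (g : ι → MvPolynomial (Fin s) k),
      g₀.IsHomogeneous (d + 1) → (∀ j, (g j).IsHomogeneous d) →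
      aeval w g₀ + ∑ j, aeval w (g j) * y j = 0 → ∀ j, g j = 0) :
    (aeval (R := k) w).toRingHom.Flat := by
  classical
  let := (aeval (R := k) w).toRingHom.toAlgebra
  have htower : IsScalarTower k (MvPolynomial (Fin s) k) F :=
    .of_algebraMap_eq fun x => ((aeval (R := k) w).commutes x).symm
  have hsmul (p : MvPolynomial (Fin s) k) (x : F) : p • x = aeval w p * x := Algebra.smul_def p x
  let v : Option ι → F := fun o => o.elim 1 y
  have hli : LinearIndependent (MvPolynomial (Fin s) k) v := by
    rw [Fintype.linearIndependent_iff]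
    intro g hg
    rw [Fintype.sum_option] at hg
    simp only [hsmul] at hg
    have hg' : aeval w (g none) + ∑ j, aeval w (g (some j)) * y j = 0 := by
      simpa [v] using hg
    have hcomp (d : ℕ) (j : ι) : MvPolynomial.homogeneousComponent d (g (some j)) = 0 := by
      refine hind d (MvPolynomial.homogeneousComponent (d + 1) (g none))
        (fun j => MvPolynomial.homogeneousComponent d (g (some j)))
        (MvPolynomial.homogeneousComponent_isHomogeneous _ _)
        (fun j => MvPolynomial.homogeneousComponent_isHomogeneous _ _) ?_ j
      have h1 := congrArg (GradedAlgebra.proj 𝒜 (d + 1)) hg'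
      simpa only [map_add, map_sum, map_zero, GradedAlgebra.proj_apply, decompose_aeval hw,
        DirectSum.coe_decompose_mul_add_of_right_mem 𝒜 (hy _)] using h1
    have hsome (j : ι) : g (some j) = 0 := by
      rw [← (g (some j)).sum_homogeneousComponent]
      exact Finset.sum_eq_zero fun d _ => hcomp d j
    simp only [hsome, map_zero, zero_mul, Finset.sum_const_zero, add_zero] at hg'
    rintro (_ | j)
    · exact (algebraicIndependent_iff.mp hai) _ hg'
    · exact hsome j
  have htop : ⊤ ≤ Submodule.span (MvPolynomial (Fin s) k) (Set.range v) := by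
    set N := Submodule.span (MvPolynomial (Fin s) k) (Set.range v) with hN
    have hwN (u : F) (hu : u ∈ Submodule.span k (Set.range w)) (x : F) (hx : x ∈ N) :
        u * x ∈ N := by
      have hle : Submodule.span k (Set.range w) ≤
          LinearMap.range (aeval (R := k) w).toLinearMap := by
        rw [Submodule.span_le]
        rintro _ ⟨i, rfl⟩
        exact ⟨MvPolynomial.X i, MvPolynomial.aeval_X w i⟩
      obtain ⟨p, rfl⟩ := hle hu
      change aeval w p * x ∈ N
      rw [← hsmul]
      exact N.smul_mem _ hx
    have h1N : (1 : F) ∈ N := Submodule.subset_span ⟨none, rfl⟩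
    have hyN : Submodule.span k (Set.range y) ≤ N.restrictScalars k := by
      rw [Submodule.span_le]
      rintro _ ⟨j, rfl⟩
      exact Submodule.subset_span ⟨some j, rfl⟩
    have hall (i : ℕ) : ∀ x ∈ 𝒜 i, x ∈ N := by
      induction i with
      | zero =>
        intro x hx
        rw [h.zero] at hx
        obtain ⟨c, rfl⟩ := Submodule.mem_one.mp hx
        rw [Algebra.algebraMap_eq_smul_one]
        exact N.smul_of_tower_mem c h1N
      | succ i ih =>
        obtain _ | i := i
        · intro x hx
          obtain ⟨u, hu, z, hz, rfl⟩ := Submodule.mem_sup.mp (hspan hx)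
          refine N.add_mem ?_ (hyN hz)
          simpa using hwN u hu 1 h1N
        · intro x hx
          have h2 : 𝒜 (i + 1 + 1) = Submodule.span k (Set.range w) * 𝒜 (i + 1) := by
            rw [h.add_one i, ← mul_assoc, hmul, h.eq_pow 2, h.eq_pow i, ← pow_add, h.eq_pow]
            congr 1
            omega
          rw [h2] at hx
          exact Submodule.mul_induction_on hx (fun u hu z hz => hwN u hu z (ih z hz))
            fun a b => N.add_mem
    intro x _
    rw [← DirectSum.sum_support_decompose 𝒜 x]
    exact Submodule.sum_mem _ fun i _ => hall i _ (SetLike.coe_mem _)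
  have : Module.Free (MvPolynomial (Fin s) k) F := Module.Free.of_basis (Module.Basis.mk hli htop)
  exact (inferInstance : Module.Flat (MvPolynomial (Fin s) k) F)

end IsStandardGraded

end FreimanIdeal

/-! ### Quasi-regular reductions with reduction number at most one. -/

namespace FreimanIdeal

open IsLocalRing RingTheory.Sequence
open scoped Pointwise

section

open MvPolynomial

theorem exists_isHomogeneous_map_eq {R k σ : Type*} [CommSemiring R] [CommSemiring k] {f : R →+* k}
    (hf : Function.Surjective f) {d : ℕ} {g : MvPolynomial σ k} (hg : g.IsHomogeneous d) :
    ∃ Φ : MvPolynomial σ R, Φ.IsHomogeneous d ∧ map f Φ = g := by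
  classical
  obtain ⟨Ψ, rfl⟩ := map_surjective f hf g
  refine ⟨homogeneousComponent d Ψ, homogeneousComponent_isHomogeneous _ _, ?_⟩
  ext m
  rw [coeff_map, coeff_homogeneousComponent]
  split_ifs with hm
  · rw [coeff_map]
  · rw [map_zero, hg.coeff_eq_zero hm]

theorem coe_aeval_reesMonomial {R σ : Type*} [CommRing R] {A : Ideal R} (x : σ → ↥(A ^ 1))
    {Φ : MvPolynomial σ R} {d : ℕ} (hΦ : Φ.IsHomogeneous d) :
    (aeval (fun i => reesMonomial A 1 (x i)) Φ : Polynomial R) =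
      Polynomial.monomial d (eval (fun i => (x i : R)) Φ) := by
  have h1 := comp_aeval_apply (fun i => reesMonomial A 1 (x i)) (reesAlgebra A).val Φ
  have h2 := hΦ.aeval_algebraMap_mul (fun i => (x i : R)) (Polynomial.X : Polynomial R)
  refine h1.trans ?_
  rw [← Polynomial.C_mul_X_pow_eq_monomial]
  refine Eq.trans ?_ h2
  congr 1
  refine congrArg _ (_root_.funext fun i => ?_)
  exact (Polynomial.C_mul_X_eq_monomial).symm

end

open MvPolynomial (aeval eval)

theorem exists_linearIndependent_isCompl {k V : Type*} [Field k] [AddCommGroup V] [Module k V]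
    {W U : Submodule k V} (hWU : W ≤ U) [FiniteDimensional k U] :
    ∃ (n : ℕ) (y : Fin n → V), (∀ j, y j ∈ U) ∧ U = W ⊔ Submodule.span k (Set.range y) ∧
      ∀ c : Fin n → k, ∑ j, c j • y j ∈ W → ∀ j, c j = 0 := by
  obtain ⟨C, hC⟩ := W.exists_isCompl
  have hfin : FiniteDimensional k (C ⊓ U : Submodule k V) :=
    Submodule.finiteDimensional_of_le inf_le_right
  let b := Module.finBasis k (C ⊓ U : Submodule k V)
  have hb : Submodule.span k (Set.range fun i => (b i : V)) = C ⊓ U := by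
    have := congrArg (Submodule.map (C ⊓ U).subtype) b.span_eq
    rwa [Submodule.map_span, Submodule.map_subtype_top, ← Set.range_comp] at this
  refine ⟨_, fun i => (b i : V), fun j => (b j).2.2, ?_, fun c hc => ?_⟩
  · rw [hb, ← sup_inf_assoc_of_le _ hWU, hC.sup_eq_top, top_inf_eq]
  · have hmem : ∑ j, c j • (b j : V) ∈ C := Submodule.sum_mem _ fun j _ => C.smul_mem _ (b j).2.1
    have h0 := Submodule.disjoint_def.mp hC.disjoint _ hc hmem
    exact Fintype.linearIndependent_iff.mp
      (b.linearIndependent.map' _ (Submodule.ker_subtype _)) c h0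

namespace IsFiberMap

universe u

variable {R : Type u} {k F : Type*} [CommRing R] [IsLocalRing R] [IsNoetherianRing R] [Field k]
  [CommRing F] [Algebra R k] [Algebra k F] [Algebra R F] [IsScalarTower R k F] {A : Ideal R}
  {π : reesAlgebra A →ₐ[R] F} (h : IsFiberMap k (maximalIdeal R) π)

omit [IsNoetherianRing R] in
-- Lift the relation to R: Φ₀(x) + Σ Φ_j(x) y_j lies in 𝔪A^(d+1) = (𝔪A)L^d, so it equals Ψ(x) with Ψ
-- of degree d and coefficients in 𝔪A. The form Σ y_j Φ_j - Ψ then takes the value -Φ₀(x) in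
-- L^(d+1), so its coefficients lie in L. Reading these modulo L + 𝔪A, independence of the y_j kills
-- every coefficient.
theorem coeff_eq_zero_of_isQuasiRegularFamily {s : ℕ} {x : Fin s → ↥(A ^ 1)}
    (hqr : IsQuasiRegularFamily fun i => (x i : R))
    (hpow : ∀ d, A ^ (d + 1) = A * Ideal.span (Set.range fun i => (x i : R)) ^ d)
    {n : ℕ} (y : Fin n → ↥(A ^ 1))
    (hy : ∀ c : Fin n → k, ∑ j, c j • cls π 1 (y j) ∈
      h.piece 1 (Ideal.span (Set.range fun i => (x i : R))) → ∀ j, c j = 0)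
    {d : ℕ} {g₀ : MvPolynomial (Fin s) k} {g : Fin n → MvPolynomial (Fin s) k}
    (hg₀ : g₀.IsHomogeneous (d + 1)) (hg : ∀ j, (g j).IsHomogeneous d)
    (h0 : aeval (fun i => cls π 1 (x i)) g₀ +
      ∑ j, aeval (fun i => cls π 1 (x i)) (g j) * cls π 1 (y j) = 0) (j : Fin n) : g j = 0 := by
  set L := Ideal.span (Set.range fun i => (x i : R)) with hL
  have hLA : L ≤ A ^ 1 := Ideal.span_le.mpr (by rintro _ ⟨i, rfl⟩; exact (x i).2)
  obtain ⟨Φ₀, hΦ₀, rfl⟩ := exists_isHomogeneous_map_eq h.surjective_algebraMap hg₀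
  choose Φ hΦ hΦg using fun j => exists_isHomogeneous_map_eq h.surjective_algebraMap (hg j)
  obtain rfl : (fun j => MvPolynomial.map (algebraMap R k) (Φ j)) = g := funext hΦg
  have hπ (Ψ : MvPolynomial (Fin s) R) : π (aeval (fun i => reesMonomial A 1 (x i)) Ψ) =
      aeval (fun i => cls π 1 (x i)) (MvPolynomial.map (algebraMap R k) Ψ) := by
    rw [MvPolynomial.aeval_map_algebraMap, MvPolynomial.comp_aeval_apply]
    rfl
  have hz : π (aeval (fun i => reesMonomial A 1 (x i)) Φ₀ +
      ∑ j, aeval (fun i => reesMonomial A 1 (x i)) (Φ j) * reesMonomial A 1 (y j)) = 0 := by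
    rw [map_add, map_sum]
    simp_rw [map_mul, hπ]
    exact h0
  have hcoeff := coeff_mem_of_mem_map ((h.map_eq_zero_iff _).mp hz) (d + 1)
  simp only [Subalgebra.coe_add, AddSubmonoidClass.coe_finsetSum, Subalgebra.coe_mul,
    coe_aeval_reesMonomial x hΦ₀, coe_aeval_reesMonomial x (hΦ _), coe_reesMonomial,
    Polynomial.monomial_mul_monomial, Polynomial.coeff_add, Polynomial.finsetSum_coeff,
    Polynomial.coeff_monomial_same] at hcoeff
  rw [hpow, ← mul_assoc] at hcoeff
  obtain ⟨Ψ, hΨ, hΨm, hΨe⟩ := exists_isHomogeneous_coeff_mem_of_mem_mul_pow hcoeff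
  have hΘ : (∑ j, MvPolynomial.C (y j : R) * Φ j - Ψ).IsHomogeneous d := by
    refine (MvPolynomial.IsHomogeneous.sum _ _ _ fun j _ => ?_).sub hΨ
    simpa using (MvPolynomial.isHomogeneous_C _ (y j : R)).mul (hΦ j)
  have hΘe : eval (fun i => (x i : R)) (∑ j, MvPolynomial.C (y j : R) * Φ j - Ψ) ∈ L ^ (d + 1) := by
    have h1 : eval (fun i => (x i : R)) Φ₀ ∈ L ^ (d + 1) := by
      have := eval_mem_mul_pow_of_coeff_mem (x := fun i => (x i : R)) (I := ⊤) hΦ₀ fun _ => trivial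
      rwa [Ideal.top_mul] at this
    have h2 : eval (fun i => (x i : R)) (∑ j, MvPolynomial.C (y j : R) * Φ j - Ψ) =
        - eval (fun i => (x i : R)) Φ₀ := by
      rw [map_sub, hΨe, map_sum]
      simp only [map_mul, MvPolynomial.eval_C, mul_comm (y _ : R)]
      ring
    rw [h2]
    exact neg_mem h1
  ext m
  rw [MvPolynomial.coeff_map, MvPolynomial.coeff_zero]
  refine hy (fun j => algebraMap R k ((Φ j).coeff m)) ?_ j
  have hm := coeff_mem_of_eval_mem_pow (hqr d) hΘ hΘe m
  simp only [MvPolynomial.coeff_sub, MvPolynomial.coeff_sum, MvPolynomial.coeff_C_mul] at hm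
  have hsum : ∑ j, algebraMap R k ((Φ j).coeff m) • cls π 1 (y j) =
      cls π 1 (∑ j, (Φ j).coeff m • y j) := by
    simp_rw [map_sum, map_smul, algebraMap_smul]
  rw [hsum]
  have hle : L ⊔ maximalIdeal R * A ^ 1 ≤ A ^ 1 := sup_le hLA Ideal.mul_le_right
  refine (h.piece_le_piece_iff hle hLA).mpr le_rfl (h.cls_mem_piece _ ?_)
  have hval : ((∑ j, (Φ j).coeff m • y j : ↥(A ^ 1)) : R) =
      (∑ j, (y j : R) * (Φ j).coeff m - Ψ.coeff m) + Ψ.coeff m := by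
    simp [mul_comm]
  rw [hval]
  exact Submodule.add_mem_sup hm (by simpa using hΨm m)

include h in
theorem isCohenMacaulay_of_reductionNumber_le_one [Infinite k] {l : ℕ} (hl : ringKrullDim F = l)
    (hA : A ≤ maximalIdeal R) (hred : reductionNumber A ≤ 1)
    (hheight : ∀ q : Ideal R, q.IsPrime → A ≤ q → l ≤ q.height)
    {rs : List R} (hrs : ∀ r ∈ rs, r ∈ maximalIdeal R) (hreg : IsRegular R rs)
    (hdim : ringKrullDim R ≤ rs.length) :
    IsCohenMacaulay F ∧
      Submodule.spanFinrank (A ^ 2) + l.choose 2 = l * Submodule.spanFinrank A := by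
  have hSG := h.isStandardGraded (IsNoetherian.noetherian A)
  let := h.gradedAlgebra
  have : Nontrivial F := nontrivial_of_ringKrullDim_eq hl
  obtain ⟨J, hJ, hJA2⟩ : ∃ J, IsMinimalReduction J A ∧ A ^ (1 + 1) = J * A ^ 1 := by
    have hlt : reductionNumber A < 2 := hred.trans_lt (by norm_num)
    obtain ⟨J, hJ⟩ := iInf_lt_iff.mp hlt
    obtain ⟨hJm, hJ⟩ := iInf_lt_iff.mp hJ
    obtain ⟨i, hi⟩ := iInf_lt_iff.mp hJ
    obtain ⟨hi1, hi2⟩ := iInf_lt_iff.mp hi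
    have hi3 : i < 2 := by exact_mod_cast hi2
    refine ⟨J, hJm, ?_⟩
    interval_cases i
    · have : A = J := by simpa using hi1
      rw [← this, pow_add]
      simp
    · exact hi1
  have hJA := hJ.1.1
  obtain ⟨s, w, hw, hai, hr⟩ := hSG.exists_algebraicIndependent (h.piece_one_le hJA)
    ((h.isReduction_iff hJA).mp hJ.1)
  have hw1 (i) : w i ∈ h.component 1 := h.piece_one_le hJA (hw i)
  obtain ⟨x, hxJ, hxw, hspan⟩ := h.exists_lift hw
  obtain rfl : (fun i => cls π 1 (x i)) = w := funext hxw
  have hsl : l = s := by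
    have h3 := hSG.ringKrullDim_eq hw1 hr hai
    rw [hl] at h3
    exact_mod_cast h3
  subst hsl
  have hLJ : Ideal.span (Set.range fun i => (x i : R)) ≤ J := by
    refine Ideal.span_le.mpr ?_
    rintro _ ⟨i, rfl⟩
    exact hxJ i
  have hLred : IsReduction (Ideal.span (Set.range fun i => (x i : R))) A := by
    rw [h.isReduction_iff (hLJ.trans hJA), hspan, ideal_span_submodule_span]
    exact hr
  -- Minimality of J forces it to be generated by the lifts of a Noether normalization, that is, by
  -- l elements.
  have hLeq := hLJ.lt_or_eq.resolve_left (hJ.2 _ hLred)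
  rw [← hLeq] at hJA2
  set L := Ideal.span (Set.range fun i => (x i : R)) with hL
  have hLA : L ≤ A := hLJ.trans hJA
  have hpow (d : ℕ) : A ^ (d + 1) = A * L ^ d := by
    induction d with
    | zero => simp
    | succ d ih =>
      rw [pow_succ, ih, mul_comm, ← mul_assoc, ← pow_two, hJA2, pow_one, pow_succ]
      ring
  have hxm : ∀ z ∈ List.ofFn (fun i => (x i : R)), z ∈ maximalIdeal R := by
    intro z hz
    obtain ⟨i, rfl⟩ := List.mem_ofFn.mp hz
    exact hA ((pow_one A).le (x i).2)
  have hofList : Ideal.ofList (List.ofFn fun i => (x i : R)) = L := by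
    rw [Ideal.ofList, hL]
    congr 1
    ext z
    simp [List.mem_ofFn]
  have hregx : IsRegular R (List.ofFn fun i => (x i : R)) := by
    refine isRegular_of_supportDim_add_length_le _ rfl hrs hreg hxm ?_
    rw [hofList, smul_eq_mul, Ideal.mul_top, Module.supportDim_quotient_eq_ringKrullDim,
      List.length_ofFn]
    -- Primes containing L contain A because A² = LA ⊆ L, so they have height at least l; hence L
    -- cuts down l dimensions and its generators are regular.
    refine (ringKrullDim_quotient_add_le L l fun q hq hLq => hheight q hq ?_).trans hdim
    refine (hq.pow_le_iff (two_ne_zero)).mp ?_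
    rw [show A ^ 2 = L * A by rw [show 2 = 1 + 1 from rfl, hJA2, pow_one]]
    exact Ideal.mul_le_left.trans hLq
  have hqr : IsQuasiRegularFamily fun i => (x i : R) :=
    ((isWeaklyRegular_ofFn_iff _).mp hregx.toIsWeaklyRegular).isQuasiRegularFamily
  have hWV : Submodule.span k (Set.range fun i => cls π 1 (x i)) ≤ h.component 1 := by
    rw [← hspan]
    exact h.piece_one_le hLA
  have hfin := hSG.finiteDimensional 1
  obtain ⟨n, y, hyV, hsup, hyW⟩ := exists_linearIndependent_isCompl hWV
  choose Y _ hY using hyV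
  obtain rfl : (fun j => cls π 1 (Y j)) = y := funext hY
  have hmul : Submodule.span k (Set.range fun i => cls π 1 (x i)) * h.component 1 =
      h.component 2 := by
    rw [← hspan]
    exact (h.mul_pow_eq_iff hLA 1).mp hJA2
  have hflat := hSG.flat_aeval_of_forall_isHomogeneous hw1 (fun j => h.cls_mem_component (Y j))
    hmul hsup.le hai fun d g₀ g hg₀ hg h0 =>
      h.coeff_eq_zero_of_isQuasiRegularFamily hqr hpow Y (by rwa [hspan]) hg₀ hg h0
  refine ⟨hSG.isCohenMacaulay_of_flat hw1 hr hai hflat, ?_⟩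
  have := hSG.finrank_add_choose_of_flat hw1 hai hflat
  rwa [hmul, h.finrank_component, h.finrank_component, pow_one] at this

end IsFiberMap

end FreimanIdeal

/-! ### Invariance of the fiber ring under localization. -/

namespace FreimanIdeal

open IsLocalRing RingTheory.Sequence
open scoped Pointwise

section Transfer

variable {R : Type*} [CommRing R]

/-- The algebra structures are transported along e, so a ring built over another base, such as the
fiber cone over S, can itself serve as the fiber ring of the local ideal. -/
theorem IsFiberMap.of_ringEquiv [IsLocalRing R] {A : Ideal R} {F : Type*} [CommRing F]
    (e : F ≃+* reesAlgebra A ⧸ (maximalIdeal R).map (algebraMap R (reesAlgebra A))) :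
    ∃ (_ : Algebra R F) (_ : Algebra (ResidueField R) F) (_ : IsScalarTower R (ResidueField R) F)
      (π : reesAlgebra A →ₐ[R] F), IsFiberMap (ResidueField R) (maximalIdeal R) π := by
  let q := Ideal.Quotient.mk ((maximalIdeal R).map (algebraMap R (reesAlgebra A)))
  let ψ : R →+* F := (e.symm.toRingHom.comp q).comp (algebraMap R (reesAlgebra A))
  have hψ : ∀ r ∈ maximalIdeal R, ψ r = 0 := fun r hr => by
    change e.symm (q _) = 0
    exact (RingEquiv.map_eq_zero_iff e.symm).mpr
      (Ideal.Quotient.eq_zero_iff_mem.mpr (Ideal.mem_map_of_mem _ hr))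
  let i1 : Algebra R F := ψ.toAlgebra
  let ψ' : ResidueField R →+* F := Ideal.Quotient.lift (maximalIdeal R) ψ hψ
  let i2 : Algebra (ResidueField R) F := ψ'.toAlgebra
  have i3 : IsScalarTower R (ResidueField R) F := .of_algebraMap_eq fun r => rfl
  let π : reesAlgebra A →ₐ[R] F := ⟨e.symm.toRingHom.comp q, fun r => rfl⟩
  refine ⟨i1, i2, i3, π, ?_, ?_, residue_surjective⟩
  · exact e.symm.surjective.comp Ideal.Quotient.mk_surjective
  · ext x
    exact (RingEquiv.map_eq_zero_iff e.symm).trans Ideal.Quotient.eq_zero_iff_mem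

variable (m I : Ideal R) [m.IsMaximal]

/-- N/mN is a vector space over the residue field, on which s acts invertibly. -/
theorem mem_of_mul_mem_of_notMem {m : Ideal R} [m.IsMaximal] {N : Ideal R} {s a : R} (hs : s ∉ m)
    (ha : a ∈ N) (hsa : s * a ∈ m * N) : a ∈ m * N := by
  obtain ⟨u, v, hv, huv⟩ := Ideal.IsMaximal.exists_inv ‹m.IsMaximal› hs
  have : a = u * (s * a) + v * a := by linear_combination -a * huv
  rw [this]
  exact Ideal.add_mem _ (Ideal.mul_mem_left _ _ hsa) (Ideal.mul_mem_mul hv ha)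

/-- The fiber ring does not change under localization at the maximal ideal. -/
theorem nonempty_fiberRing_ringEquiv :
    Nonempty ((reesAlgebra I ⧸ m.map (algebraMap R (reesAlgebra I))) ≃+*
      (reesAlgebra (I.map (algebraMap R (Localization.AtPrime m))) ⧸
        (maximalIdeal (Localization.AtPrime m)).map (algebraMap (Localization.AtPrime m)
          (reesAlgebra (I.map (algebraMap R (Localization.AtPrime m))))))) := by
  set B := Localization.AtPrime m
  set A := I.map (algebraMap R B) with hA
  have hmem (x : reesAlgebra I) : Polynomial.map (algebraMap R B) x ∈ reesAlgebra A := by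
    rw [mem_reesAlgebra_iff]
    intro i
    rw [Polynomial.coeff_map, hA, ← Ideal.map_pow]
    exact Ideal.mem_map_of_mem _ (x.2 i)
  let ρ : reesAlgebra I →+* reesAlgebra A :=
    ((Polynomial.mapRingHom (algebraMap R B)).comp (reesAlgebra I).subtype).codRestrict
      (reesAlgebra A) hmem
  have hρ (x : reesAlgebra I) : (ρ x : Polynomial B) = Polynomial.map (algebraMap R B) x := rfl
  let q := Ideal.Quotient.mk ((maximalIdeal B).map (algebraMap B (reesAlgebra A)))
  have hmap (n : ℕ) : maximalIdeal B * A ^ n = (m * I ^ n).map (algebraMap R B) := by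
    rw [Ideal.map_mul, Ideal.map_pow, ← Localization.AtPrime.map_eq_maximalIdeal]
  have hker : RingHom.ker (q.comp ρ) = m.map (algebraMap R (reesAlgebra I)) := by
    apply le_antisymm
    · intro x hx
      have hx' : ρ x ∈ (maximalIdeal B).map (algebraMap B (reesAlgebra A)) :=
        Ideal.Quotient.eq_zero_iff_mem.mp hx
      rw [← sum_reesMonomial x]
      refine Ideal.sum_mem _ fun i _ => reesMonomial_mem_map _ ?_
      have h1 := coeff_mem_of_mem_map hx' i
      rw [hρ, Polynomial.coeff_map, hmap,
        IsLocalization.algebraMap_mem_map_algebraMap_iff m.primeCompl] at h1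
      obtain ⟨s, hs, hsx⟩ := h1
      exact mem_of_mul_mem_of_notMem hs (x.2 i) hsx
    · refine Ideal.map_le_iff_le_comap.mpr fun r hr => ?_
      refine Ideal.Quotient.eq_zero_iff_mem.mpr ?_
      have h1 : ρ (algebraMap R (reesAlgebra I) r) = algebraMap B (reesAlgebra A)
          (algebraMap R B r) := Subtype.ext (Polynomial.map_C _)
      rw [h1]
      refine Ideal.mem_map_of_mem _ ?_
      rw [← Localization.AtPrime.map_eq_maximalIdeal]
      exact Ideal.mem_map_of_mem _ hr
  have hsurj : Function.Surjective (q.comp ρ) := by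
    rw [← RingHom.range_eq_top, eq_top_iff]
    intro y _
    obtain ⟨y, rfl⟩ := Ideal.Quotient.mk_surjective y
    rw [← sum_reesMonomial y, map_sum]
    refine sum_mem fun i _ => ?_
    generalize hz : (⟨(y : Polynomial B).coeff i, y.2 i⟩ : ↥(A ^ i)) = z
    have hz1 : (z : B) ∈ (I ^ i).map (algebraMap R B) := by
      rw [Ideal.map_pow]
      exact z.2
    rw [IsLocalization.mem_map_algebraMap_iff m.primeCompl] at hz1
    obtain ⟨⟨a, s⟩, has⟩ := hz1
    -- With u an inverse of the denominator s modulo m, the fraction a/s is congruent to ua modulo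
    -- the maximal ideal times A^i, so its class comes from R.
    obtain ⟨u, v, hv, huv⟩ := Ideal.IsMaximal.exists_inv ‹m.IsMaximal› s.2
    have hua : u * (a : R) ∈ I ^ i := Ideal.mul_mem_left _ _ a.2
    refine ⟨reesMonomial I i ⟨u * a, hua⟩, ?_⟩
    have hua' : algebraMap R B (u * a) ∈ A ^ i := by
      rw [hA, ← Ideal.map_pow]
      exact Ideal.mem_map_of_mem _ hua
    have h1 : ρ (reesMonomial I i ⟨u * a, hua⟩) = reesMonomial A i ⟨_, hua'⟩ :=
      Subtype.ext (Polynomial.map_monomial _)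
    change q (ρ _) = q _
    rw [h1, Ideal.Quotient.eq, ← map_sub]
    refine reesMonomial_mem_map _ ?_
    have h2 : algebraMap R B (u * a) - z = -(algebraMap R B v * z) := by
      have := congrArg (algebraMap R B) huv
      simp only [map_mul, map_add, map_one] at this has ⊢
      linear_combination (-algebraMap R B u) * has + (z : B) * this
    change algebraMap R B (u * a) - z ∈ _
    rw [h2]
    refine neg_mem (Ideal.mul_mem_mul ?_ z.2)
    rw [← Localization.AtPrime.map_eq_maximalIdeal]
    exact Ideal.mem_map_of_mem _ hv
  exact ⟨(Ideal.quotEquivOfEq hker.symm).trans (RingHom.quotientKerEquivOfSurjective hsurj)⟩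

end Transfer

end FreimanIdeal

/-! ### Minimal generators of graded ideals, and the variables as a regular sequence. -/

namespace FreimanIdeal

open IsLocalRing RingTheory.Sequence
open scoped Pointwise

theorem IsFiberMap.exists_ringKrullDim_eq {R k F : Type*} [CommRing R] [IsLocalRing R]
    [IsNoetherianRing R] [Field k] [CommRing F] [Algebra R k] [Algebra k F] [Algebra R F]
    [IsScalarTower R k F] {A : Ideal R} {π : reesAlgebra A →ₐ[R] F}
    (h : IsFiberMap k (maximalIdeal R) π) : ∃ l : ℕ, ringKrullDim F = l := by
  let := h.gradedAlgebra
  have : Nontrivial F := by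
    rw [← not_subsingleton_iff_nontrivial]
    intro hF
    have h1 := coeff_mem_of_mem_map ((h.map_eq_zero_iff 1).mp (Subsingleton.elim _ _)) 0
    rw [pow_zero, mul_one, OneMemClass.coe_one, Polynomial.coeff_one_zero] at h1
    exact (Ideal.ne_top_iff_one _).mp (maximalIdeal.isMaximal R).ne_top h1
  exact (h.isStandardGraded (IsNoetherian.noetherian A)).exists_ringKrullDim_eq

/-- The classes of T span the degree-one component; a basis extracted from them lifts to generators
by Nakayama. -/
theorem IsFiberMap.exists_subset_span_eq {R k F : Type*} [CommRing R] [IsLocalRing R]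
    [IsNoetherianRing R] [Field k] [CommRing F] [Algebra R k] [Algebra k F] [Algebra R F]
    [IsScalarTower R k F] {T : Set R} {A : Ideal R} {π : reesAlgebra A →ₐ[R] F}
    (h : IsFiberMap k (maximalIdeal R) π) (hA : A = Ideal.span T) :
    ∃ T' ⊆ T, T'.Finite ∧ Ideal.span T' = A ∧ T'.ncard ≤ Submodule.spanFinrank A := by
  have hT : T ⊆ (A ^ 1 : Ideal R) := by
    rw [pow_one, hA]
    exact Ideal.subset_span
  have hspan := h.piece_span 1 hT
  obtain ⟨b, hbT, hb, hli⟩ := exists_linearIndependent (k)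
    {x | ∃ a, ∃ ha : a ∈ T, IsFiberMap.cls π 1 ⟨a, hT ha⟩ = x}
  have hcomp : h.component 1 = Submodule.span (k) b := by
    rw [hb, ← hspan, IsFiberMap.component, pow_one, ← hA]
  have hfin := (h.isStandardGraded (IsNoetherian.noetherian A)).finiteDimensional 1
  rw [hcomp] at hfin
  have hbfin : b.Finite := by
    have hli' : LinearIndependent (k)
        (fun x : b => (⟨x, Submodule.subset_span x.2⟩ : Submodule.span (k) b)) :=
      LinearIndependent.of_comp (Submodule.subtype _) hli
    exact hli'.finite
  have hbT' : ∀ x ∈ b, ∃ a, ∃ ha : a ∈ T, IsFiberMap.cls π 1 ⟨a, hT ha⟩ = x := fun x hx => hbT hx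
  choose! f hfT hf using hbT'
  refine ⟨f '' b, ?_, hbfin.image f, ?_, ?_⟩
  · rintro _ ⟨x, hx, rfl⟩
    exact hfT x hx
  · have hsub : f '' b ⊆ (A ^ 1 : Ideal R) := by
      rintro _ ⟨x, hx, rfl⟩
      exact hT (hfT x hx)
    rw [h.eq_pow_of_component_le (n := 1) (Ideal.span_le.mpr hsub), pow_one]
    rw [hcomp, h.piece_span 1 hsub]
    refine Submodule.span_mono fun x hx => ⟨f x, ⟨x, hx, rfl⟩, hf x hx⟩
  · have h1 := h.finrank_component 1
    rw [hcomp, pow_one] at h1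
    rw [← h1]
    have := hbfin.fintype
    rw [finrank_span_set_eq_card hli, ← Set.ncard_eq_toFinset_card']
    exact Set.ncard_image_le hbfin

/-- In a Noetherian local ring, every generating set contains a minimal generating set. -/
theorem exists_subset_span_eq_of_isLocalRing {R : Type*} [CommRing R] [IsLocalRing R]
    [IsNoetherianRing R] (T : Set R) :
    ∃ T' ⊆ T, T'.Finite ∧ Ideal.span T' = Ideal.span T ∧
      T'.ncard ≤ Submodule.spanFinrank (Ideal.span T) := by
  obtain ⟨_, _, _, π, h⟩ := IsFiberMap.of_ringEquiv (A := Ideal.span T)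
    (F := reesAlgebra (Ideal.span T) ⧸
      (maximalIdeal R).map (algebraMap R (reesAlgebra (Ideal.span T)))) (RingEquiv.refl _)
  exact h.exists_subset_span_eq rfl

section Graded

open MvPolynomial

attribute [local instance] MvPolynomial.gradedAlgebra

variable {K : Type*} [Field K] {n : ℕ}

theorem decompose_zero_eq_C (f : MvPolynomial (Fin n) K) :
    (DirectSum.decompose (homogeneousSubmodule (Fin n) K) f 0 : MvPolynomial (Fin n) K) =
      C (constantCoeff f) := by
  refine (decomposition.decompose'_apply f 0).trans ?_
  rw [homogeneousComponent_zero, constantCoeff_eq]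

theorem notMem_irrelevantIdeal_iff {f : MvPolynomial (Fin n) K} :
    f ∉ irrelevantIdeal K n ↔ constantCoeff f ≠ 0 := by
  rw [irrelevantIdeal_eq_ker, RingHom.mem_ker]

theorem IsGraded.le_irrelevantIdeal {I : Ideal (MvPolynomial (Fin n) K)} (hI : IsGraded I)
    (htop : I ≠ ⊤) : I ≤ irrelevantIdeal K n := by
  intro f hf
  by_contra hf0
  rw [notMem_irrelevantIdeal_iff] at hf0
  have h1 := hI 0 hf
  rw [decompose_zero_eq_C] at h1
  exact htop (Ideal.eq_top_of_isUnit_mem _ h1 ((isUnit_iff_ne_zero.mpr hf0).map C))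

theorem IsGraded.pow {I : Ideal (MvPolynomial (Fin n) K)} (hI : IsGraded I) (i : ℕ) :
    IsGraded (I ^ i) := by
  induction i with
  | zero =>
    intro i f _
    rw [pow_zero, Ideal.one_eq_top]
    trivial
  | succ i ih =>
    rw [pow_succ]
    exact Ideal.IsHomogeneous.mul ih hI

/-- A homogeneous element of a graded ideal can be detected after localizing at the irrelevant
ideal. -/
theorem IsGraded.mem_of_algebraMap_mem {N : Ideal (MvPolynomial (Fin n) K)} (hN : IsGraded N)
    {z : MvPolynomial (Fin n) K} (hz : SetLike.IsHomogeneousElem (homogeneousSubmodule (Fin n) K) z)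
    (h : algebraMap _ (Localization.AtPrime (irrelevantIdeal K n)) z ∈ localize N) : z ∈ N := by
  rw [localize, IsLocalization.algebraMap_mem_map_algebraMap_iff
    (irrelevantIdeal K n).primeCompl] at h
  obtain ⟨s, hs, hsz⟩ := h
  have hs0 : constantCoeff s ≠ 0 := notMem_irrelevantIdeal_iff.mp hs
  obtain ⟨d, hd⟩ := hz
  have h1 := hN (0 + d) hsz
  rw [DirectSum.coe_decompose_mul_add_of_right_mem _ hd, decompose_zero_eq_C] at h1
  have h2 := N.mul_mem_left (C (constantCoeff s)⁻¹) h1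
  rwa [← mul_assoc, ← C_mul, inv_mul_cancel₀ hs0, C_1, one_mul] at h2

/-- Minimal local generators can be selected among the images of homogeneous generators. Their
homogeneous preimages span a graded ideal with the same localization, and a graded ideal is
determined by its localization at 𝔪. -/
theorem IsGraded.spanFinrank_localize {N : Ideal (MvPolynomial (Fin n) K)} (hN : IsGraded N) :
    Submodule.spanFinrank (localize N) = mu N := by
  have hfg : N.FG := IsNoetherian.noetherian N
  apply le_antisymm
  · have h1 : localize N = Ideal.span (algebraMap _ (Localization.AtPrime (irrelevantIdeal K n)) ''
        Submodule.generators N) := by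
      rw [← Ideal.map_span]
      exact congrArg localize N.span_generators.symm
    have hfin := Submodule.FG.finite_generators hfg
    rw [h1, mu, ← Submodule.FG.generators_ncard hfg]
    exact (Submodule.spanFinrank_span_le_ncard_of_finite (hfin.image _)).trans
      (Set.ncard_image_le hfin)
  · obtain ⟨S, hS⟩ := (Ideal.IsHomogeneous.iff_exists _ _).mp hN
    set T : Set (MvPolynomial (Fin n) K) := (↑) '' S with hT
    have hThom (z) (hz : z ∈ T) :
        SetLike.IsHomogeneousElem (homogeneousSubmodule (Fin n) K) z := by
      obtain ⟨z, -, rfl⟩ := hz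
      exact z.2
    obtain ⟨T', hT'T, hT'fin, hspan, hcard⟩ := exists_subset_span_eq_of_isLocalRing
      (algebraMap _ (Localization.AtPrime (irrelevantIdeal K n)) '' T)
    rw [← Ideal.map_span, ← hS] at hspan hcard
    choose! f hfT hf using hT'T
    have hN' : IsGraded (Ideal.span (f '' T')) := by
      refine Ideal.homogeneous_span _ _ ?_
      rintro _ ⟨x, hx, rfl⟩
      exact hThom _ (hfT hx)
    have hloc : localize (Ideal.span (f '' T')) = localize N := by
      have : localize N = Ideal.span T' := hspan.symm
      rw [this, localize, Ideal.map_span, ← Set.image_comp]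
      congr 1
      exact (Set.image_congr fun x hx => hf hx).trans (Set.image_id T')
    have hNle : N ≤ Ideal.span (f '' T') := by
      rw [hS]
      refine Ideal.span_le.mpr fun z hz => hN'.mem_of_algebraMap_mem (hThom z hz) ?_
      rw [hloc, hS]
      exact Ideal.mem_map_of_mem _ (Ideal.subset_span hz)
    have heq : N = Ideal.span (f '' T') := by
      refine le_antisymm hNle (Ideal.span_le.mpr ?_)
      rintro _ ⟨x, hx, rfl⟩
      rw [hS]
      exact Ideal.subset_span (hfT hx)
    refine le_trans ?_ hcard
    rw [mu]
    nth_rw 1 [heq]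
    exact (Submodule.spanFinrank_span_le_ncard_of_finite (hT'fin.image f)).trans
      (Set.ncard_image_le hT'fin)

theorem IsGraded.delta_eq_zero_iff {I : Ideal (MvPolynomial (Fin n) K)} (hI : IsGraded I) :
    Delta I = 0 ↔ Submodule.spanFinrank (localize I ^ 2) + (analyticSpread I).choose 2 =
      analyticSpread I * Submodule.spanFinrank (localize I) := by
  have h2 : localize I ^ 2 = localize (I ^ 2) := (Ideal.map_pow _ _ _).symm
  rw [h2, (hI.pow 2).spanFinrank_localize, hI.spanFinrank_localize, Delta]
  zify
  constructor <;> intro h <;> linear_combination h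

theorem exists_isRegular_localization_irrelevantIdeal :
    ∃ rs : List (Localization.AtPrime (irrelevantIdeal K n)), (∀ r ∈ rs, r ∈ maximalIdeal _) ∧
      IsRegular (Localization.AtPrime (irrelevantIdeal K n)) rs ∧
      ringKrullDim (Localization.AtPrime (irrelevantIdeal K n)) ≤ rs.length := by
  have hreg := isWeaklyRegular_aeval_X_of_monic n (fun _ => (Polynomial.X : Polynomial K))
    fun _ => Polynomial.monic_X
  have hmem : ∀ r ∈ List.ofFn fun i : Fin n => Polynomial.aeval
      (X i.rev : MvPolynomial (Fin n) K) (Polynomial.X : Polynomial K),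
        r ∈ irrelevantIdeal K n := by
    intro r hr
    obtain ⟨i, rfl⟩ := List.mem_ofFn.mp hr
    rw [Polynomial.aeval_X]
    exact Ideal.subset_span ⟨_, rfl⟩
  refine ⟨_, ?_, hreg.isRegular_of_isLocalization_of_mem
    (Localization.AtPrime (irrelevantIdeal K n)) (irrelevantIdeal K n) hmem, ?_⟩
  · intro r hr
    obtain ⟨q, hq, rfl⟩ := List.mem_map.mp hr
    exact (IsLocalization.AtPrime.to_map_mem_maximal_iff _ (irrelevantIdeal K n) _).mpr (hmem q hq)
  · rw [IsLocalization.AtPrime.ringKrullDim_eq_height (irrelevantIdeal K n)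
      (Localization.AtPrime (irrelevantIdeal K n))]
    refine (Ideal.height_le_ringKrullDim_of_ne_top Ideal.IsPrime.ne_top').trans ?_
    rw [MvPolynomial.ringKrullDim_of_isNoetherianRing]
    simp

end Graded

end FreimanIdeal

/-! ### The theorem. -/

theorem theorem1p4 {K : Type*} [Field K] {n : ℕ}
    (I : Ideal (MvPolynomial (Fin n) K)) (hI : FreimanIdeal.IsGraded I) :
    (FreimanIdeal.Delta I = 0 → FreimanIdeal.IsCohenMacaulay (FreimanIdeal.FiberCone I) →
      FreimanIdeal.gradedReductionNumber I ≤ 1 ∧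
      (Infinite K → FreimanIdeal.mu I ≠ FreimanIdeal.analyticSpread I →
        FreimanIdeal.gradedReductionNumber I = 1)) ∧
    (Infinite K → FreimanIdeal.IsEquimultiple I → FreimanIdeal.gradedReductionNumber I ≤ 1 →
      FreimanIdeal.Delta I = 0 ∧ FreimanIdeal.IsCohenMacaulay (FreimanIdeal.FiberCone I)) := by
  open FreimanIdeal IsLocalRing in
  let B := Localization.AtPrime (irrelevantIdeal K n)
  obtain ⟨e⟩ := nonempty_fiberRing_ringEquiv (irrelevantIdeal K n) I
  obtain ⟨_, _, _, π, h⟩ := IsFiberMap.of_ringEquiv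
    (A := I.map (algebraMap (MvPolynomial (Fin n) K) B)) (F := FiberCone I) e
  have hinf : Infinite K → Infinite (ResidueField B) := fun _ =>
    Infinite.of_injective (((algebraMap B (ResidueField B)).comp
      (algebraMap (MvPolynomial (Fin n) K) B)).comp MvPolynomial.C) (RingHom.injective _)
  -- The dimension is a natural number, so the default values in `analyticSpread` never intervene.
  have hl : ringKrullDim (FiberCone I) = analyticSpread I := by
    obtain ⟨l, hl⟩ := h.exists_ringKrullDim_eq
    rw [analyticSpread, hl]
    rfl
  have hΔ := hI.delta_eq_zero_iff
  have hmu := hI.spanFinrank_localize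
  refine ⟨fun hD hCM => ?_, fun hK heq hred => ?_⟩
  · have hle := h.reductionNumber_le_one hCM hl (hΔ.mp hD)
    refine ⟨hle, fun hK hne => le_antisymm hle ?_⟩
    have := hinf hK
    exact h.one_le_reductionNumber hl (hmu.trans_ne hne)
  · have := hinf hK
    obtain ⟨rs, hrs, hreg, hdim⟩ := exists_isRegular_localization_irrelevantIdeal (K := K) (n := n)
    -- The unit ideal has infinite height, so it cannot be equimultiple.
    have htop : I ≠ ⊤ := by
      rintro rfl
      rw [IsEquimultiple, Ideal.height_top] at heq
      exact ENat.top_ne_natCast _ heq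
    have hle : localize I ≤ IsLocalRing.maximalIdeal B := by
      rw [← Localization.AtPrime.map_eq_maximalIdeal]
      exact Ideal.map_mono (hI.le_irrelevantIdeal htop)
    have key := h.isCohenMacaulay_of_reductionNumber_le_one hl hle hred (fun q hq hIq => ?_)
      hrs hreg hdim
    · exact ⟨hΔ.mpr key.2, key.1⟩
    · rw [← IsLocalization.height_under (irrelevantIdeal K n).primeCompl q, ← heq]
      exact Ideal.height_mono (Ideal.map_le_iff_le_comap.mp hIq)
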